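/- Let $n\ge 2$, let $G=\mathbb{C}^*$ act on $X=\mathbb{C}^2\setminus\{0\}$ by $t\cdot(z_1,z_2)=(tz_1,t^nz_2)$, and let $\mathbb{P}(1,n)=[X/G]$. Its inertia is $[I_GX/G]$, where $I_GX=\{(g,x)\in G\times X: gx=x\}=\coprod_{m\in\mathbb{Z}/n}X^m$ and $X^m$ is the sector $g=e^{2\pi i m/n}$, so that $X^0=X$ and $X^m=Z:=\{z_1=0\}$ for $m\ne 0$. Let $K(I\mathbb{P}(1,n))_{\mathbb{C}}=\mathbb{C}\otimes K_G(I_GX)$ be the Grothendieck group of $G$-equivariant algebraic vector bundles on $I_GX$, with complex coefficients. Equip it with the virtual (orbifold) product $$x*y=\mu_*\bigl(e_1^*x\cdot e_2^*y\cdot \lambda_{-1}(\mathscr{R}^*)\bigr).$$ Here $e_1,e_2,\mu:\{(g_1,g_2,x): g_1x=g_2x=x\}\to I_GX$ send $(g_1,g_2,x)$ to $(g_1,x)$, $(g_2,x)$ and $(g_1g_2,x)$. With $T_X$ the tangent class of $[X/G]$ pulled back to the double inertia and $T_{I}$, $T_{I^2}$ the tangent classes of the inertia and the double inertia, $\mathscr{R}=T_X+T_{I^2}-e_1^*T_I-e_2^*T_I$.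 Explicitly, $\mathscr{R}$ is the line bundle of weight $1$ on the components with $g_1\neq1\neq g_2$, and is $0$ elsewhere. The identity $\mathbf 1$ is the class of the structure sheaf of $X^0$. The virtual Adams operations are the $\mathbb{C}$-linear maps $\widetilde\psi^k(x)=\psi^k(x)\cdot\theta^k(\mathscr{S}^*)$ for $k\ge1$. Here $\psi^k$ is the ordinary Adams operation, extended $\mathbb{C}$-linearly, and $\mathscr{S}$ is the normal bundle of the projection $I_GX\to X$: it is $0$ on $X^0$ and the line bundle of weight $1$ on $X^m$ for $m\neq0$. The Bott class is given by $\theta^k(0)=1$ and $\theta^k(L)=1+L+\dots+L^{k-1}$ for a line bundle $L$. A virtual line element is an element $\mathscr{L}\in K(I\mathbb{P}(1,n))_{\mathbb{C}}$ that is invertible for the virtual product and satisfies $\widetilde\psi^k(\mathscr{L})=\mathscr{L}^{*k}$ (the $k$-th virtual power) for all $k\ge1$. Let $\mathcal{P}$ be the set of virtual line elements. **Proposition.** $\mathcal{P}$ spans $K(I\mathbb{P}(1,n))_{\mathbb{C}}$ as a complex vector space. -/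

import Mathlib

noncomputable section

namespace WeightedLine

open Matrix

/-! ### Functions on a torus, charts, and regular functions -/

/-- The algebra `ℂ[Γ]` of functions on the torus with character group `Γ`; the basis
element `single γ 1` is the monomial with exponent `γ`. -/
abbrev TorusAlg (Γ : Type) [AddCommGroup Γ] : Type := AddMonoidAlgebra ℂ Γ

/-- The functions all of whose monomials have exponent in `S`. -/
def funcs {Γ : Type} [AddCommGroup Γ] (S : Set Γ) : Submodule ℂ (TorusAlg Γ) :=
  AddMonoidAlgebra.supported ℂ ℂ S

/-- A `ℂˣ`-variety glued from affine `ℂˣ`-stable charts `Uᵢ` (`i : I`) that all contain one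
torus with character group `Γ`: `chart i` is the monoid of exponents of the monomials regular
on `Uᵢ`, so that `𝒪(Uᵢ) = funcs (chart i)` and `𝒪(Uᵢ ∩ Uⱼ) = funcs (chart i ⊔ chart j)`;
`deg γ` is the degree of the monomial `γ`: it satisfies `γ(t · z) = t ^ deg γ * γ(z)`. -/
structure Charts (Γ I : Type) [AddCommGroup Γ] where
  deg : Γ →+ ℤ
  chart : I → AddSubmonoid Γ

namespace Charts

variable {Γ I : Type} [AddCommGroup Γ] (U : Charts Γ I)

/-- The functions that are homogeneous of degree `d`: `f(t · z) = t ^ d * f(z)`. -/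
def homog (d : ℤ) : Submodule ℂ (TorusAlg Γ) := funcs {γ | U.deg γ = d}

/-- The functions regular on the `i`-th chart. -/
def reg (i : I) : Submodule ℂ (TorusAlg Γ) := funcs (U.chart i : Set Γ)

/-- The functions regular on the intersection of the `i`-th and the `j`-th chart. -/
def regOn (i j : I) : Submodule ℂ (TorusAlg Γ) := funcs ((U.chart i ⊔ U.chart j : AddSubmonoid Γ) : Set Γ)

/-- A `ℂˣ`-equivariant algebraic vector bundle, given by equivariant frames over the charts and
its transition functions. Over `Uᵢ` there is a frame `e₁, …, eᵣ` whose `a`-th member spans the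
character of weight `wt i a` (the group acts by `t · (z, eₐ) = (t z, t ^ wt i a eₐ)`), and
`trans i j` turns coordinates in the `j`-th frame into coordinates in the `i`-th frame.
Equivariance says that the `(a, b)` entry is homogeneous of degree `wt i a - wt j b`.
On the charts used below every equivariant bundle has such frames: `{z₁ ≠ 0}` is `ℂˣ × 𝔸¹` and
`{z₂ ≠ 0}` is `ℂˣ ×_{μₙ} 𝔸¹`, and (`μₙ`-equivariant) bundles on `𝔸¹` are trivial up to characters. -/
structure Bundle where
  rank : ℕ
  wt : I → Fin rank → ℤ
  trans : I → I → Matrix (Fin rank) (Fin rank) (TorusAlg Γ)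
  trans_self : ∀ i, trans i i = 1
  trans_mul : ∀ i j k, trans i j * trans j k = trans i k
  trans_reg : ∀ i j a b, trans i j a b ∈ U.regOn i j
  trans_homog : ∀ i j a b, trans i j a b ∈ U.homog (wt i a - wt j b)

variable {U}

/-- Homomorphisms of equivariant vector bundles, in the given frames. -/
structure Hom (E F : U.Bundle) where
  mat : I → Matrix (Fin F.rank) (Fin E.rank) (TorusAlg Γ)
  mat_reg : ∀ i a b, mat i a b ∈ U.reg i
  mat_homog : ∀ i a b, mat i a b ∈ U.homog (F.wt i a - E.wt i b)
  comm : ∀ i j, mat i * E.trans i j = F.trans i j * mat j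

/-- `0 → E' → E → E'' → 0` (with maps `u`, `v`) is a short exact sequence of vector bundles.
Over each chart the modules of sections are free, so exactness means that the sequence of
`𝒪(Uᵢ)`-modules is split by some matrices `r`, `s` (not necessarily equivariant) with
entries regular on the chart. -/
def IsShortExact {E' E E'' : U.Bundle} (u : Hom E' E) (v : Hom E E'') : Prop :=
  ∀ i, ∃ (r : Matrix (Fin E'.rank) (Fin E.rank) (TorusAlg Γ))
    (s : Matrix (Fin E.rank) (Fin E''.rank) (TorusAlg Γ)),
    (∀ a b, r a b ∈ U.reg i) ∧ (∀ a b, s a b ∈ U.reg i) ∧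
    r * u.mat i = 1 ∧ v.mat i * s = 1 ∧ u.mat i * r + s * v.mat i = 1

end Charts

/-! ### Closure properties of regular and homogeneous functions -/

section funcs

variable {Γ : Type} [AddCommGroup Γ]

theorem mem_funcs {S : Set Γ} {f : TorusAlg Γ} :
    f ∈ funcs S ↔ ∀ γ, f.coeff γ ≠ 0 → γ ∈ S := by
  unfold funcs
  rw [AddMonoidAlgebra.mem_supported]
  simp [Set.subset_def]

theorem funcs_mul {S T V : Set Γ} (h : ∀ x ∈ S, ∀ y ∈ T, x + y ∈ V) {f g : TorusAlg Γ}
    (hf : f ∈ funcs S) (hg : g ∈ funcs T) : f * g ∈ funcs V := by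
  classical
  rw [mem_funcs] at *
  intro γ hγ
  by_contra hV
  apply hγ
  rw [AddMonoidAlgebra.coeff_mul]
  refine Finset.sum_eq_zero fun x hx => Finset.sum_eq_zero fun y hy => if_neg ?_
  rintro rfl
  exact hV (h x (hf x (by simpa using hx)) y (hg y (by simpa using hy)))

theorem one_mem_funcs {S : Set Γ} (h : (0 : Γ) ∈ S) : (1 : TorusAlg Γ) ∈ funcs S := by
  classical
  rw [mem_funcs]
  intro γ hγ
  rw [AddMonoidAlgebra.one_def, AddMonoidAlgebra.coeff_single, Finsupp.single_apply] at hγ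
  split_ifs at hγ with h0
  · exact h0 ▸ h
  · exact absurd rfl hγ

theorem funcs_prod {ι : Type} (s : Finset ι) (S : ι → Set Γ) (T : Finset ι → Set Γ)
    (h0 : (0 : Γ) ∈ T ∅)
    (hT : ∀ a (t : Finset ι), a ∉ t → ∀ x ∈ S a, ∀ y ∈ T t, ∀ t', (∀ b, b ∈ t' ↔ b = a ∨ b ∈ t) →
      x + y ∈ T t')
    (f : ι → TorusAlg Γ) (hf : ∀ a, f a ∈ funcs (S a)) : ∏ a ∈ s, f a ∈ funcs (T s) := by
  classical
  induction s using Finset.induction_on with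
  | empty => simpa using one_mem_funcs h0
  | insert a s ha ih =>
    rw [Finset.prod_insert ha]
    exact funcs_mul (fun x hx y hy => hT a s ha x hx y hy _ (by simp)) (hf a) ih

theorem det_mem_funcs {k : ℕ} (M : AddSubmonoid Γ) (A : Matrix (Fin k) (Fin k) (TorusAlg Γ))
    (h : ∀ a b, A a b ∈ funcs (M : Set Γ)) : A.det ∈ funcs (M : Set Γ) := by
  rw [Matrix.det_apply]
  refine Submodule.sum_mem _ fun σ _ => ?_
  rw [Units.smul_def]
  refine zsmul_mem ?_ _
  exact funcs_prod Finset.univ (fun _ => (M : Set Γ)) (fun _ => (M : Set Γ)) M.zero_mem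
    (fun _ _ _ x hx y hy _ _ => M.add_mem hx hy) _ fun a => h _ _

theorem det_mem_homog {k : ℕ} (deg : Γ →+ ℤ) (p q : Fin k → ℤ)
    (A : Matrix (Fin k) (Fin k) (TorusAlg Γ))
    (h : ∀ a b, A a b ∈ funcs {γ | deg γ = p a - q b}) :
    A.det ∈ funcs {γ | deg γ = ∑ a, p a - ∑ b, q b} := by
  classical
  rw [Matrix.det_apply]
  refine Submodule.sum_mem _ fun σ _ => ?_
  rw [Units.smul_def]
  refine zsmul_mem ?_ _
  have := funcs_prod Finset.univ (fun a => {γ | deg γ = p (σ a) - q a})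
    (fun t => {γ | deg γ = ∑ a ∈ t, (p (σ a) - q a)}) (by simp)
    (fun a t ha x hx y hy t' ht' => by
      obtain rfl : t' = insert a t := by ext b; simp [ht']
      simp only [Set.mem_ofPred_eq] at *
      rw [map_add, hx, hy, Finset.sum_insert ha]) (fun a => A (σ a) a) fun a => h _ _
  rw [Finset.sum_sub_distrib, Equiv.sum_comp σ p] at this
  exact this

end funcs

/-! ### Tensor products, exterior powers, characters -/

/-- The matrix of all `k × k` minors of `A`, indexed by the `k`-element subsets. -/
def minors {R : Type} [CommRing R] {r : ℕ} (k : ℕ) (A : Matrix (Fin r) (Fin r) R) :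
    Matrix (Set.powersetCard (Fin r) k) (Set.powersetCard (Fin r) k) R :=
  fun s t => (A.submatrix (s.1.orderEmbOfFin s.2) (t.1.orderEmbOfFin t.2)).det

theorem minors_eq_toMatrix {R : Type} [CommRing R] {r : ℕ} (k : ℕ)
    (A : Matrix (Fin r) (Fin r) R) :
    minors k A = LinearMap.toMatrix ((Pi.basisFun R (Fin r)).exteriorPower k)
      ((Pi.basisFun R (Fin r)).exteriorPower k) (exteriorPower.map k (Matrix.toLin' A)) := by
  ext s t
  rw [LinearMap.toMatrix_apply, exteriorPower.basis_repr_apply, exteriorPower.coe_basis,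
    exteriorPower.map_apply_ιMulti_family, exteriorPower.ιMulti_family,
    exteriorPower.ιMultiDual_apply_ιMulti, minors, ← Matrix.det_transpose]
  congr 1
  ext a b
  simp [Set.powersetCard.ofFinEmbEquiv_symm_apply]

theorem minors_one {R : Type} [CommRing R] {r : ℕ} (k : ℕ) :
    minors k (1 : Matrix (Fin r) (Fin r) R) = 1 := by
  rw [minors_eq_toMatrix, Matrix.toLin'_one, exteriorPower.map_id, LinearMap.toMatrix_id]

theorem minors_mul {R : Type} [CommRing R] {r : ℕ} (k : ℕ) (A B : Matrix (Fin r) (Fin r) R) :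
    minors k (A * B) = minors k A * minors k B := by
  simp only [minors_eq_toMatrix]
  rw [Matrix.toLin'_mul, exteriorPower.map_comp, ← LinearMap.toMatrix_comp]

/-- An enumeration of the `k`-element subsets of `Fin r`. -/
def subsetEquiv (r k : ℕ) : Set.powersetCard (Fin r) k ≃ Fin (r.choose k) :=
  (Finite.equivFin _).trans (finCongr (by
    rw [Set.powersetCard.card, Nat.card_fin]))

namespace Charts

variable {Γ I : Type} [AddCommGroup Γ] (U : Charts Γ I)

/-- The trivial line bundle on which the group acts through its character of weight `w`. -/
def char (w : ℤ) : U.Bundle where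
  rank := 1
  wt _ _ := w
  trans _ _ := 1
  trans_self _ := rfl
  trans_mul _ _ _ := one_mul _
  trans_reg i j a b := by
    rw [Subsingleton.elim a b, Matrix.one_apply_eq]
    exact one_mem_funcs (zero_mem _)
  trans_homog i j a b := by
    rw [Subsingleton.elim a b, Matrix.one_apply_eq]
    exact one_mem_funcs (by simp)

variable {U}

/-- The tensor product of two equivariant vector bundles. -/
def tensor (E F : U.Bundle) : U.Bundle where
  rank := E.rank * F.rank
  wt i a := E.wt i a.divNat + F.wt i a.modNat
  trans i j := fun a b => E.trans i j a.divNat b.divNat * F.trans i j a.modNat b.modNat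
  trans_self i := by
    have : (fun a b => E.trans i i a.divNat b.divNat * F.trans i i a.modNat b.modNat) =
      (Matrix.kroneckerMap (· * ·) (E.trans i i) (F.trans i i)).submatrix
        finProdFinEquiv.symm finProdFinEquiv.symm := rfl
    rw [this, E.trans_self, F.trans_self]
    have h1 := Matrix.one_kronecker_one (m := Fin E.rank) (n := Fin F.rank) (α := TorusAlg Γ)
    rw [h1, Matrix.submatrix_one_equiv]
  trans_mul i j k := by
    have : ∀ i j, (fun a b => E.trans i j a.divNat b.divNat * F.trans i j a.modNat b.modNat) =
      (Matrix.kroneckerMap (· * ·) (E.trans i j) (F.trans i j)).submatrix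
        finProdFinEquiv.symm finProdFinEquiv.symm := fun _ _ => rfl
    rw [this, this, this, Matrix.submatrix_mul_equiv]
    have h := Matrix.mul_kronecker_mul (E.trans i j) (E.trans j k) (F.trans i j) (F.trans j k)
    rw [← h, E.trans_mul, F.trans_mul]
  trans_reg i j a b :=
    funcs_mul (fun x hx y hy => add_mem hx hy) (E.trans_reg i j _ _) (F.trans_reg i j _ _)
  trans_homog i j a b :=
    funcs_mul (fun x hx y hy => by
      simp only [Set.mem_ofPred_eq] at *
      rw [map_add, hx, hy]; ring) (E.trans_homog i j _ _) (F.trans_homog i j _ _)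

/-- The `k`-th exterior power: the frame members are the `k`-fold wedge products and the
transition functions are the `k × k` minors. -/
def exterior (k : ℕ) (E : U.Bundle) : U.Bundle where
  rank := E.rank.choose k
  wt i a := ∑ x ∈ ((subsetEquiv E.rank k).symm a).1, E.wt i x
  trans i j := (minors k (E.trans i j)).submatrix (subsetEquiv E.rank k).symm
    (subsetEquiv E.rank k).symm
  trans_self i := by rw [E.trans_self, minors_one, Matrix.submatrix_one_equiv]
  trans_mul i j l := by rw [Matrix.submatrix_mul_equiv, ← minors_mul, E.trans_mul]
  trans_reg i j a b := det_mem_funcs _ _ fun _ _ => E.trans_reg _ _ _ _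
  trans_homog i j a b := by
    have h := det_mem_homog U.deg
      (fun x => E.wt i (((subsetEquiv E.rank k).symm a).1.orderEmbOfFin
        ((subsetEquiv E.rank k).symm a).2 x))
      (fun x => E.wt j (((subsetEquiv E.rank k).symm b).1.orderEmbOfFin
        ((subsetEquiv E.rank k).symm b).2 x)) _ (fun x y => E.trans_homog i j _ _)
    have key : ∀ (s : Set.powersetCard (Fin E.rank) k) (i : I),
        ∑ x, E.wt i (s.1.orderEmbOfFin s.2 x) = ∑ x ∈ s.1, E.wt i x := by
      intro s i
      conv_rhs => rw [← Finset.map_orderEmbOfFin_univ s.1 s.2, Finset.sum_map]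
      rfl
    rw [key, key] at h
    exact h

/-! ### The Grothendieck ring with complex coefficients and its Adams operations -/

/-- The relations of the Grothendieck ring: `[E] = [E'] + [E'']` for a short exact sequence
`0 → E' → E → E'' → 0`, `[E ⊗ F] = [E][F]`, and `[𝒪] = 1`. -/
inductive KRel : MvPolynomial U.Bundle ℂ → Prop
  | exact {E' E E'' : U.Bundle} (u : Hom E' E) (v : Hom E E'') (h : IsShortExact u v) :
      KRel (.X E - .X E' - .X E'')
  | tensor (E F : U.Bundle) : KRel (.X (tensor E F) - .X E * .X F)
  | one : KRel (.X (U.char 0) - 1)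

variable (U)

/-- The equivariant K-theory `K ⊗ ℂ` of the variety, with its ordinary product, by generators
(the classes of equivariant vector bundles) and relations. As a product of classes is the class of
the tensor product, this is, as a vector space, the Grothendieck group of equivariant vector
bundles tensored with `ℂ`. -/
abbrev KTheory : Type := MvPolynomial U.Bundle ℂ ⧸ Ideal.span {p | KRel (U := U) p}

variable {U}

/-- The class of an equivariant vector bundle. -/
def cls (E : U.Bundle) : U.KTheory := Ideal.Quotient.mk _ (MvPolynomial.X E)

variable (U) in
/-- The class of the trivial line bundle of weight `w`. -/
def charCls (w : ℤ) : U.KTheory := cls (U.char w)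

/-- Given the values `lam 1, lam 2, …` of the exterior power operations on an element, the value
of the `k`-th Adams operation, determined by Newton's identity
`ψᵏ = λ¹ ψᵏ⁻¹ - λ² ψᵏ⁻² + ⋯ + (-1)ᵏ λᵏ⁻¹ ψ¹ + (-1)ᵏ⁺¹ k λᵏ`, that is by
`∑ λⁱ tⁱ = exp (∑ (-1)ᵏ⁻¹ ψᵏ tᵏ / k)`. -/
def newton {R : Type} [CommRing R] (lam : ℕ → R) (k : ℕ) : R :=
  (-1) ^ (k + 1) * k * lam k +
    ∑ i : Fin (k - 1), (-1) ^ (i : ℕ) * lam (i + 1) * newton lam (k - 1 - i)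
termination_by k
decreasing_by omega

/-- The value of the `k`-th Adams operation on the class of a vector bundle. -/
def adamsCls (k : ℕ) (E : U.Bundle) : U.KTheory := newton (fun i => cls (exterior i E)) k

variable (U) in
/-- The graph of the `k`-th Adams operation: the ordinary Adams operation is the `ℂ`-linear
map with the prescribed value on the class of every vector bundle, and its graph is the
linear span of the pairs (class, value). -/
def adamsGraph (k : ℕ) : Submodule ℂ (U.KTheory × U.KTheory) :=
  Submodule.span ℂ (Set.range fun E : U.Bundle => (cls E, adamsCls k E))

variable (U) in
/-- The `k`-th Bott class `1 + L + ⋯ + Lᵏ⁻¹` of the line bundle `L` of weight `w`. -/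
def bott (k : ℕ) (w : ℤ) : U.KTheory := ∑ i ∈ Finset.range k, U.charCls w ^ i

variable (U) in
/-- The Euler class `λ₋₁(L*) = 1 - [L*]` of the line bundle `L` of weight `w`. -/
def euler (w : ℤ) : U.KTheory := 1 - U.charCls (-w)

end Charts

/-! ### The sectors of the inertia of `ℙ(1,n)` -/

/-- `X = ℂ² ∖ {0}` with coordinates `z₁, z₂` and the action `t · (z₁, z₂) = (t z₁, tⁿ z₂)`, covered
by the charts `z₁ ≠ 0` (index `0`) and `z₂ ≠ 0` (index `1`). The exponent of `z₁ⁱ z₂ʲ` is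
`(i, j)`. -/
def planeCharts (n : ℕ) : Charts (ℤ × ℤ) (Fin 2) where
  deg := AddMonoidHom.fst ℤ ℤ + (n : ℤ) • AddMonoidHom.snd ℤ ℤ
  chart := ![(AddSubmonoid.nonneg ℤ).comap (AddMonoidHom.snd ℤ ℤ),
    (AddSubmonoid.nonneg ℤ).comap (AddMonoidHom.fst ℤ ℤ)]

/-- `Z = {z₁ = 0} ⊆ X`, the fixed locus of `ζᵐ` for `m ≠ 0`: one chart, the torus with
coordinate `z₂`, on which the action is `t · z₂ = tⁿ z₂`. -/
def lineCharts (n : ℕ) : Charts ℤ Unit where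
  deg := (n : ℤ) • AddMonoidHom.id ℤ
  chart _ := ⊤

/-- Equivariant K-theory of `X` with complex coefficients. -/
abbrev KX (n : ℕ) : Type := (planeCharts n).KTheory

/-- Equivariant K-theory of `Z` with complex coefficients. -/
abbrev KZ (n : ℕ) : Type := (lineCharts n).KTheory

/-! ### Restriction from `X` to `Z` -/

/-- The value at `z₁ = 0` of a function regular for `z₂ ≠ 0`. -/
def atZero : TorusAlg (ℤ × ℤ) →ₗ[ℂ] TorusAlg ℤ :=
  (AddMonoidAlgebra.coeffLinearEquiv ℂ).symm.toLinearMap ∘ₗ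
    Finsupp.lcomapDomain (fun j : ℤ => ((0 : ℤ), j)) (fun _ _ h => (Prod.ext_iff.1 h).2) ∘ₗ
    (AddMonoidAlgebra.coeffLinearEquiv ℂ).toLinearMap

theorem coeff_atZero (f : TorusAlg (ℤ × ℤ)) (j : ℤ) : (atZero f).coeff j = f.coeff (0, j) := rfl

theorem atZero_one : atZero 1 = 1 := by
  ext j
  rw [coeff_atZero, AddMonoidAlgebra.one_def, AddMonoidAlgebra.one_def,
    AddMonoidAlgebra.coeff_single, AddMonoidAlgebra.coeff_single]
  simp [Finsupp.single_apply, Prod.ext_iff]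

theorem atZero_single (γ : ℤ × ℤ) (c : ℂ) :
    atZero (.single γ c) = if γ.1 = 0 then .single γ.2 c else 0 := by
  ext j
  rw [coeff_atZero, AddMonoidAlgebra.coeff_single, Finsupp.single_apply]
  split_ifs with h1 h2 h2
  · rw [AddMonoidAlgebra.coeff_single, h1, Finsupp.single_eq_same]
  · exact absurd (by rw [h1]) h2
  · rw [AddMonoidAlgebra.coeff_single, Finsupp.single_apply, if_neg]
    exact fun h => h1 (Prod.ext h2 h)
  · rfl

theorem funcs_induction {Γ : Type} [AddCommGroup Γ] {S : Set Γ} (P : TorusAlg Γ → Prop)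
    (h0 : P 0) (hadd : ∀ f g, P f → P g → P (f + g)) (hs : ∀ γ ∈ S, ∀ c, P (.single γ c))
    (f : TorusAlg Γ) (hf : f ∈ funcs S) : P f := by
  rw [mem_funcs] at hf
  rw [← AddMonoidAlgebra.sum_coeff_single f]
  exact Finset.sum_induction _ P hadd h0 fun γ hγ => hs γ (hf γ (by simpa using hγ)) _

theorem atZero_mul {n : ℕ} {f g : TorusAlg (ℤ × ℤ)} (hf : f ∈ (planeCharts n).reg 1)
    (hg : g ∈ (planeCharts n).reg 1) : atZero (f * g) = atZero f * atZero g := by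
  have hsingle : ∀ γ δ : ℤ × ℤ, 0 ≤ γ.1 → 0 ≤ δ.1 → ∀ c d : ℂ,
      atZero (.single γ c * .single δ d) = atZero (.single γ c) * atZero (.single δ d) := by
    intro γ δ hγ hδ c d
    rw [AddMonoidAlgebra.single_mul_single, atZero_single, atZero_single, atZero_single]
    by_cases h1 : γ.1 = 0
    · by_cases h2 : δ.1 = 0
      · rw [if_pos h1, if_pos h2, if_pos (by rw [Prod.fst_add, h1, h2, add_zero]),
          AddMonoidAlgebra.single_mul_single, Prod.snd_add]
      · rw [if_neg h2, if_neg (by rw [Prod.fst_add, h1, zero_add]; exact h2), mul_zero]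
    · have : (γ + δ).1 ≠ 0 := by
        rw [Prod.fst_add]; omega
      rw [if_neg h1, if_neg this, zero_mul]
  have hleft : ∀ γ : ℤ × ℤ, 0 ≤ γ.1 → ∀ c : ℂ,
      atZero (.single γ c * g) = atZero (.single γ c) * atZero g := by
    intro γ hγ c
    have h := funcs_induction (S := ((planeCharts n).chart 1 : Set (ℤ × ℤ)))
      (fun g => atZero (.single γ c * g) = atZero (.single γ c) * atZero g)
      (by rw [mul_zero, map_zero, mul_zero])
      (fun f f' h h' => by rw [mul_add, map_add, h, h', map_add, mul_add])
      (fun δ hδ d => hsingle γ δ hγ hδ c d)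
    exact h g hg
  have h := funcs_induction (S := ((planeCharts n).chart 1 : Set (ℤ × ℤ)))
    (fun f => atZero (f * g) = atZero f * atZero g)
    (by rw [zero_mul, map_zero, zero_mul])
    (fun f f' h h' => by rw [add_mul, map_add, h, h', map_add, add_mul])
    (fun γ hγ c => hleft γ hγ c)
  exact h f hf

theorem map_atZero_one (r : ℕ) : (1 : Matrix (Fin r) (Fin r) (TorusAlg (ℤ × ℤ))).map atZero = 1 :=
  Matrix.map_one _ (map_zero _) atZero_one

theorem map_atZero_mul {n a b c : ℕ} (A : Matrix (Fin a) (Fin b) (TorusAlg (ℤ × ℤ)))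
    (B : Matrix (Fin b) (Fin c) (TorusAlg (ℤ × ℤ)))
    (hA : ∀ i j, A i j ∈ (planeCharts n).reg 1) (hB : ∀ i j, B i j ∈ (planeCharts n).reg 1) :
    (A * B).map atZero = A.map atZero * B.map atZero := by
  ext1 i j
  rw [Matrix.map_apply, Matrix.mul_apply, Matrix.mul_apply, map_sum]
  exact Finset.sum_congr rfl fun k _ => atZero_mul (hA i k) (hB k j)

open Charts

variable {n : ℕ}

/-- The restriction to `Z` of an equivariant vector bundle on `X`: `Z` lies in the chart `z₂ ≠ 0`,
so the restriction has the frame of that chart. -/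
def restrictBundle (E : (planeCharts n).Bundle) : (lineCharts n).Bundle where
  rank := E.rank
  wt _ := E.wt 1
  trans _ _ := 1
  trans_self _ := rfl
  trans_mul _ _ _ := one_mul _
  trans_reg _ _ a b := by
    rw [Matrix.one_apply]
    split_ifs
    · exact one_mem_funcs (zero_mem _)
    · exact zero_mem _
  trans_homog _ _ a b := by
    rw [Matrix.one_apply]
    split_ifs with h
    · exact one_mem_funcs (by simp [h])
    · exact zero_mem _

/-- The restriction to `Z` of a homomorphism. -/
def restrictHom {E F : (planeCharts n).Bundle} (u : Hom E F) :
    Hom (restrictBundle E) (restrictBundle F) where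
  mat _ := (u.mat 1).map atZero
  mat_reg _ a b := mem_funcs.2 fun _ _ => AddSubmonoid.mem_top _
  mat_homog _ a b := by
    refine mem_funcs.2 fun j hj => ?_
    have h := mem_funcs.1 (u.mat_homog 1 a b) (0, j) hj
    simpa [planeCharts, lineCharts, restrictBundle] using h
  comm _ _ := by
    exact (Matrix.mul_one ((u.mat 1).map atZero)).trans (Matrix.one_mul ((u.mat 1).map atZero)).symm

theorem restrict_exact {E' E E'' : (planeCharts n).Bundle} (u : Hom E' E) (v : Hom E E'')
    (h : IsShortExact u v) : IsShortExact (restrictHom u) (restrictHom v) := by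
  intro _
  obtain ⟨r, s, hr, hs, h1, h2, h3⟩ := h 1
  refine ⟨r.map atZero, s.map atZero, fun a b => mem_funcs.2 fun _ _ => AddSubmonoid.mem_top _,
    fun a b => mem_funcs.2 fun _ _ => AddSubmonoid.mem_top _, ?_, ?_, ?_⟩
  · exact (map_atZero_mul r _ hr (u.mat_reg 1)).symm.trans (by rw [h1, map_atZero_one]; rfl)
  · exact (map_atZero_mul _ s (v.mat_reg 1) hs).symm.trans (by rw [h2, map_atZero_one]; rfl)
  · have := congrArg (fun M => M.map atZero) h3
    simp only [map_atZero_one] at this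
    rw [Matrix.map_add _ (map_add atZero), map_atZero_mul _ r (u.mat_reg 1) hr,
      map_atZero_mul s _ hs (v.mat_reg 1)] at this
    exact this

theorem restrict_tensor (E F : (planeCharts n).Bundle) :
    restrictBundle (tensor E F) = tensor (restrictBundle E) (restrictBundle F) := by
  have h : (tensor (restrictBundle E) (restrictBundle F)).trans = fun _ _ => 1 := by
    funext i j
    exact (tensor (restrictBundle E) (restrictBundle F)).trans_self i
  have h' : ∀ B : (lineCharts n).Bundle, ∀ t, (ht : B.trans = t) → ∀ h1 h2 h3 h4,
      (⟨B.rank, B.wt, t, h1, h2, h3, h4⟩ : (lineCharts n).Bundle) = B := by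
    rintro B _ rfl _ _ _ _
    rfl
  exact h' _ _ h _ _ _ _

/-- The restriction (pullback) of K-theory classes from `X` to `Z`. -/
def restrict (n : ℕ) : KX n →ₐ[ℂ] KZ n :=
  Ideal.Quotient.liftₐ _ (MvPolynomial.aeval fun E => cls (restrictBundle E)) <| by
    intro p hp
    have key : ∀ q : MvPolynomial (planeCharts n).Bundle ℂ, KRel q →
        MvPolynomial.aeval (fun E => cls (restrictBundle E)) q = (0 : KZ n) := by
      rintro _ (⟨u, v, h⟩ | ⟨E, F⟩ | _)
      · simp only [map_sub, MvPolynomial.aeval_X]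
        exact (Ideal.Quotient.eq_zero_iff_mem (I := Ideal.span {p | KRel p})).2
          (Ideal.subset_span (KRel.exact _ _ (restrict_exact u v h)))
      · simp only [map_sub, map_mul, MvPolynomial.aeval_X, restrict_tensor]
        exact (Ideal.Quotient.eq_zero_iff_mem (I := Ideal.span {p | KRel p})).2
          (Ideal.subset_span (KRel.tensor _ _))
      · simp only [map_sub, map_one, MvPolynomial.aeval_X]
        exact (Ideal.Quotient.eq_zero_iff_mem (I := Ideal.span {p | KRel p})).2
          (Ideal.subset_span KRel.one)
    have hle : Ideal.span {p | KRel (U := planeCharts n) p} ≤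
        RingHom.ker (MvPolynomial.aeval (R := ℂ) fun E : (planeCharts n).Bundle =>
          (cls (restrictBundle E) : KZ n)) := Ideal.span_le.2 fun q hq => key q hq
    exact hle hp

theorem restrict_cls (E : (planeCharts n).Bundle) :
    restrict n (cls E) = cls (restrictBundle E) := by
  refine (Ideal.Quotient.lift_mk _ _ _).trans ?_
  exact MvPolynomial.aeval_X _ _

/-! ### Pushforward from `Z` to `X` -/

/-- Evaluation at the point `z₂ = 1`, with values in the representation ring of the stabilizer
`ℤ/n` of that point. -/
def evalOne (n : ℕ) : TorusAlg ℤ →+* AddMonoidAlgebra ℂ (ZMod n) :=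
  (AddMonoidAlgebra.lift ℂ (AddMonoidAlgebra ℂ (ZMod n)) ℤ 1).toRingHom

theorem weights_exact {E' E E'' : (lineCharts n).Bundle} (u : Hom E' E) (v : Hom E E'')
    (h : IsShortExact u v) :
    (∑ a, (.single (E.wt () a : ZMod n) 1 : AddMonoidAlgebra ℂ (ZMod n))) =
      ∑ a, .single (E'.wt () a : ZMod n) 1 + ∑ a, .single (E''.wt () a : ZMod n) 1 := by
  classical
  obtain ⟨r, s, -, -, h1, h2, h3⟩ := h ()
  let D : ∀ B : (lineCharts n).Bundle, Matrix (Fin B.rank) (Fin B.rank)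
    (AddMonoidAlgebra ℂ (ZMod n)) := fun B => Matrix.diagonal fun a => .single (B.wt () a : ZMod n) 1
  have tr : ∀ B, (D B).trace = ∑ a, .single (B.wt () a : ZMod n) 1 := fun B =>
    Matrix.trace_diagonal _
  have comm : ∀ {B C : (lineCharts n).Bundle} (w : Hom B C),
      D C * (w.mat ()).map (evalOne n) = (w.mat ()).map (evalOne n) * D B := by
    intro B C w
    ext1 a b
    rw [Matrix.diagonal_mul, Matrix.mul_diagonal, Matrix.map_apply, mul_comm]
    by_cases h0 : w.mat () a b = 0
    · rw [h0, map_zero, zero_mul, zero_mul]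
    · congr 2
      obtain ⟨j, hj⟩ : ∃ j, (w.mat () a b).coeff j ≠ 0 := by
        by_contra hc
        push Not at hc
        exact h0 (AddMonoidAlgebra.ext (Finsupp.ext hc))
      have := mem_funcs.1 (w.mat_homog () a b) j hj
      have h4 : (n : ℤ) * j = C.wt () a - B.wt () b := by
        simpa [lineCharts] using this
      have h5 := congrArg (Int.cast : ℤ → ZMod n) h4
      push_cast at h5
      rw [ZMod.natCast_self, zero_mul] at h5
      exact (sub_eq_zero.1 h5.symm)
  have m1 : r.map (evalOne n) * (u.mat ()).map (evalOne n) = 1 := by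
    rw [← Matrix.map_mul, h1, Matrix.map_one _ (map_zero _) (map_one _)]
  have m2 : (v.mat ()).map (evalOne n) * s.map (evalOne n) = 1 := by
    rw [← Matrix.map_mul, h2, Matrix.map_one _ (map_zero _) (map_one _)]
  have m3 : (u.mat ()).map (evalOne n) * r.map (evalOne n) +
      s.map (evalOne n) * (v.mat ()).map (evalOne n) = 1 := by
    rw [← Matrix.map_mul, ← Matrix.map_mul, ← Matrix.map_add _ (map_add _), h3,
      Matrix.map_one _ (map_zero _) (map_one _)]
  rw [← tr, ← tr, ← tr]
  calc (D E).trace = (D E * ((u.mat ()).map (evalOne n) * r.map (evalOne n)) +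
        D E * (s.map (evalOne n) * (v.mat ()).map (evalOne n))).trace := by
        rw [← Matrix.mul_add, m3, Matrix.mul_one]
    _ = (D E').trace + (D E'').trace := by
        rw [Matrix.trace_add]
        congr 1
        · rw [← Matrix.mul_assoc, comm u, Matrix.mul_assoc, Matrix.trace_mul_comm,
            Matrix.mul_assoc, m1, Matrix.mul_one]
        · rw [Matrix.trace_mul_comm, Matrix.mul_assoc, ← comm v, Matrix.trace_mul_comm,
            Matrix.mul_assoc, m2, Matrix.mul_one]

/-- The class in the representation ring of `ℤ/n` of the fibre at `z₂ = 1` of an equivariant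
vector bundle on `Z`. -/
def fibre (n : ℕ) : KZ n →ₐ[ℂ] AddMonoidAlgebra ℂ (ZMod n) :=
  Ideal.Quotient.liftₐ _ (MvPolynomial.aeval fun E : (lineCharts n).Bundle =>
      ∑ a, AddMonoidAlgebra.single (E.wt () a : ZMod n) 1) <| by
    intro p hp
    have key : ∀ q : MvPolynomial (lineCharts n).Bundle ℂ, KRel q →
        MvPolynomial.aeval (fun E : (lineCharts n).Bundle =>
          ∑ a, AddMonoidAlgebra.single (E.wt () a : ZMod n) (1 : ℂ)) q = 0 := by
      rintro _ (⟨u, v, h⟩ | ⟨E, F⟩ | _)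
      · simp only [map_sub, MvPolynomial.aeval_X]
        rw [weights_exact u v h]
        abel
      · simp only [map_sub, map_mul, MvPolynomial.aeval_X]
        rw [sub_eq_zero, Finset.sum_mul_sum, ← Finset.sum_product']
        refine Fintype.sum_equiv finProdFinEquiv.symm _ _ fun a => ?_
        rw [AddMonoidAlgebra.single_mul_single, mul_one, ← Int.cast_add]
        rfl
      · simp only [map_sub, map_one, MvPolynomial.aeval_X]
        rw [sub_eq_zero]
        refine (Fin.sum_univ_one _).trans ?_
        rw [AddMonoidAlgebra.one_def]
        congr 1
        exact Int.cast_zero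
    have hle : Ideal.span {p | KRel (U := lineCharts n) p} ≤
        RingHom.ker (MvPolynomial.aeval (R := ℂ) fun E : (lineCharts n).Bundle =>
          ∑ a, AddMonoidAlgebra.single (E.wt () a : ZMod n) (1 : ℂ)) :=
      Ideal.span_le.2 fun q hq => key q hq
    exact hle hp

/-- The pushforward `ι_*` of K-theory classes along the inclusion `ι : Z → X`. An equivariant vector
bundle on `Z` is a direct sum of characters `ℂ_w` with `0 ≤ w < n` (because `z₂` is invertible of
degree `n`), and multiplication by `z₁` gives the resolution `0 → ℂ_{w-1} → ℂ_w → ι_* ℂ_w → 0`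
by vector bundles on `X`. -/
def push (n : ℕ) : KZ n →ₗ[ℂ] KX n :=
  Finsupp.linearCombination ℂ (fun c : ZMod n =>
      (planeCharts n).charCls c.val - (planeCharts n).charCls (c.val - 1)) ∘ₗ
    (AddMonoidAlgebra.coeffLinearEquiv ℂ).toLinearMap ∘ₗ (fibre n).toLinearMap

/-! ### Virtual K-theory of `ℙ(1,n)` and its virtual line elements -/

/-- `K(Iℙ(1,n)) ⊗ ℂ` as a vector space. The inertia manifold `{(g, x) | g x = x} ⊆ ℂˣ × X` is the
disjoint union of the sectors `g = ζᵐ` for `m : ZMod n`, where `ζ = exp (2πi/n)`: the sector of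
`m = 0` is `X`, those of `m ≠ 0` are `Z`. The first component is the class on the untwisted
sector, the second one gives the classes on the twisted sectors. -/
abbrev IK (n : ℕ) : Type := KX n × ({m : ZMod n // m ≠ 0} → KZ n)

/-- The virtual product `x * y = μ_* (e₁^* x · e₂^* y · euler R)`. On the double sector of
`(m₁, m₂)`, which is `X` if `m₁ = m₂ = 0` and `Z` otherwise, the class
`R = T_X + T_{I²} - e₁^* T_I - e₂^* T_I` is `0` if `m₁ = 0` or `m₂ = 0`, and otherwise it is
`T_X|_Z - T_Z`, the line bundle of weight `1`; the multiplication map `μ` to the sector of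
`m₁ + m₂` is the inclusion `Z → X` if `m₁ + m₂ = 0`, `m₁ ≠ 0`, and an identity otherwise. -/
def virtualMul [NeZero n] (x y : IK n) : IK n :=
  (x.1 * y.1 + ∑ m : {m : ZMod n // m ≠ 0},
      push n (x.2 m * y.2 ⟨-m.1, neg_ne_zero.2 m.2⟩ * (lineCharts n).euler 1),
    fun m => restrict n x.1 * y.2 m + x.2 m * restrict n y.1 +
      ∑ k : {k : ZMod n // k ≠ 0}, if h : m.1 - k.1 ≠ 0 then
        x.2 k * y.2 ⟨m.1 - k.1, h⟩ * (lineCharts n).euler 1 else 0)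

/-- The identity of the virtual product: the structure sheaf of the untwisted sector. -/
def virtualOne (n : ℕ) : IK n := (1, 0)

/-- The `k`-th power of `x` with respect to the virtual product. -/
def virtualPow [NeZero n] (x : IK n) : ℕ → IK n
  | 0 => virtualOne n
  | k + 1 => virtualMul (virtualPow x k) x

/-- `y` is the value at `x` of the `k`-th virtual Adams operation `x ↦ ψᵏ(x) · θᵏ(S*)`, where `ψᵏ`
is the ordinary Adams operation and `S` is the normal bundle of the projection from the
inertia manifold to `X`: it is `0` on the untwisted sector and the line bundle of weight `1`
on the twisted ones. -/
def IsVirtualAdams (k : ℕ) (x y : IK n) : Prop :=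
  (x.1, y.1) ∈ (planeCharts n).adamsGraph k ∧
    ∀ m, ∃ z, (x.2 m, z) ∈ (lineCharts n).adamsGraph k ∧ y.2 m = z * (lineCharts n).bott k (-1)

/-- The virtual line elements: the elements `L` that are invertible for the virtual product and
whose virtual Adams operations are the virtual powers, `ψ̃ᵏ(L) = Lᵏ` for all `k ≥ 1`. -/
def virtualLineElements (n : ℕ) [NeZero n] : Set (IK n) :=
  {L | (∃ L', virtualMul L L' = virtualOne n ∧ virtualMul L' L = virtualOne n) ∧
    ∀ k : ℕ, 1 ≤ k → IsVirtualAdams k L (virtualPow L k)}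

end WeightedLine

end

/-!
The characters of `ℂˣ` account for all of the K-theory involved. On `Z` every equivariant bundle is
visibly a sum of characters (`cls_line_mem_span`). On `X` a bundle is given by one invertible
homogeneous transition matrix; division with remainder by row operations over the chart `z₁ ≠ 0`
brings its first column to the form `(0, …, f, …, 0)`, which exhibits a line subbundle, and line
bundles on `X` are characters (`cls_plane_mem_span`). Together with `χⁿ = 1` on `Z` and the Koszul
relation `(χ - 1) (χⁿ - 1) = 0` on `X`, this presents `K(Z) ⊗ ℂ` as a quotient of the algebra of
functions on `μₙ`, by a map `phiZ`, and `K(X) ⊗ ℂ` as a quotient of the algebra of functions on `μₙ`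
with first order information at `1`, by a map `phiX`. Only these surjections are needed, not their
injectivity. Restriction, pushforward, Euler class and Adams operations are read off on
characters, which span.

In the coordinates so obtained, let `ε j = 1 - exp (-2πi j / n)` be the value of the Euler class at
the point `j` of `μₙ ≅ ℤ/n`. For `j ≠ 0` the fibre of the virtual ring at `j` is the group algebra
`ℂ[ℤ/n]`, the basis element of `m ≠ 0` being the structure sheaf of the `m`-th sector divided by
`ε j`; at `j = 0` the fibre is a square-zero extension of `ℂ`. The `k`-th virtual Adams operation
is the pullback along `j ↦ k j`. Hence a tangent vector at `j = 0` and an element `ℓ` of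
`ℂ[ℤ/n] ≅ ℂⁿ` with `ℓ ^ n = 1` give a virtual line element, with component `ℓ ^ j` at `j`
(`lineElt_mem`). The tangent directions are differences of such elements, and since the coordinates
of `ℓ` are arbitrary `n`-th roots of unity, averaging over one of them against a character isolates
a single power `j ≠ 0` and a single coordinate; so these elements span (`span_lineElt`).
-/

noncomputable section

namespace WeightedLine

namespace Charts

variable {Γ I : Type} [AddCommGroup Γ] {U : Charts Γ I}

/-! ### Regular and homogeneous functions -/

theorem one_mem_reg (i : I) : (1 : TorusAlg Γ) ∈ U.reg i := one_mem_funcs (zero_mem _)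

theorem one_mem_homog {d : ℤ} (hd : d = 0) : (1 : TorusAlg Γ) ∈ U.homog d :=
  one_mem_funcs (by simp [hd])

theorem mul_mem_homog {d e d' : ℤ} (hd : d + e = d') {f g : TorusAlg Γ} (hf : f ∈ U.homog d)
    (hg : g ∈ U.homog e) : f * g ∈ U.homog d' :=
  funcs_mul (fun x hx y hy => by simp only [Set.mem_ofPred_eq] at *; rw [map_add, hx, hy, hd]) hf hg

theorem single_mem_funcs {S : Set Γ} {γ : Γ} (h : γ ∈ S) (c : ℂ) :
    (AddMonoidAlgebra.single γ c : TorusAlg Γ) ∈ funcs S := by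
  classical
  rw [mem_funcs]
  intro δ hδ
  rw [AddMonoidAlgebra.coeff_single, Finsupp.single_apply] at hδ
  split_ifs at hδ with h0
  · exact h0 ▸ h
  · exact absurd rfl hδ

theorem single_mem_reg {i : I} {γ : Γ} (h : γ ∈ U.chart i) (c : ℂ) :
    (AddMonoidAlgebra.single γ c : TorusAlg Γ) ∈ U.reg i := single_mem_funcs h c

theorem single_mem_homog {d : ℤ} {γ : Γ} (h : U.deg γ = d) (c : ℂ) :
    (AddMonoidAlgebra.single γ c : TorusAlg Γ) ∈ U.homog d :=
  single_mem_funcs (S := {γ | U.deg γ = d}) h c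

theorem one_apply_mem_reg {m : Type} [DecidableEq m] (i : I) (a b : m) :
    (1 : Matrix m m (TorusAlg Γ)) a b ∈ U.reg i := by
  rw [Matrix.one_apply]
  split_ifs
  · exact one_mem_reg i
  · exact zero_mem _

theorem one_apply_mem_homog {m : Type} [DecidableEq m] (w : m → ℤ) (a b : m) :
    (1 : Matrix m m (TorusAlg Γ)) a b ∈ U.homog (w a - w b) := by
  rw [Matrix.one_apply]
  split_ifs with h
  · exact one_mem_homog (by rw [h, sub_self])
  · exact zero_mem _

theorem reg_le_regOn_left (i j : I) : U.reg i ≤ U.regOn i j := fun _ hf =>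
  mem_funcs.2 fun γ hγ => (le_sup_left : U.chart i ≤ U.chart i ⊔ U.chart j) (mem_funcs.1 hf γ hγ)

theorem reg_le_regOn_right (i j : I) : U.reg j ≤ U.regOn i j := fun _ hf =>
  mem_funcs.2 fun γ hγ => (le_sup_right : U.chart j ≤ U.chart i ⊔ U.chart j) (mem_funcs.1 hf γ hγ)

theorem mul_mem_regOn {i j : I} {f g : TorusAlg Γ} (hf : f ∈ U.regOn i j)
    (hg : g ∈ U.regOn i j) : f * g ∈ U.regOn i j :=
  funcs_mul (fun _ hx _ hy => add_mem hx hy) hf hg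

/-! ### Classes of bundles -/

theorem mk_eq_zero_of_rel {p : MvPolynomial U.Bundle ℂ} (h : KRel p) :
    (Ideal.Quotient.mk _ p : U.KTheory) = 0 :=
  Ideal.Quotient.eq_zero_iff_mem.2 (Ideal.subset_span h)

theorem cls_exact {E' E E'' : U.Bundle} (u : Hom E' E) (v : Hom E E'') (h : IsShortExact u v) :
    cls E = cls E' + cls E'' := by
  have := mk_eq_zero_of_rel (KRel.exact u v h)
  rw [map_sub, map_sub] at this
  have h2 : cls E - cls E' - cls E'' = 0 := this
  rw [sub_sub, sub_eq_zero] at h2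
  exact h2

theorem cls_tensor (E F : U.Bundle) : cls (tensor E F) = cls E * cls F := by
  have := mk_eq_zero_of_rel (KRel.tensor E F)
  rw [map_sub, map_mul, sub_eq_zero] at this
  exact this

theorem charCls_zero : U.charCls 0 = 1 := by
  have := mk_eq_zero_of_rel (KRel.one (U := U))
  rw [map_sub, map_one, sub_eq_zero] at this
  exact this

/-- The zero homomorphism. -/
def zeroHom (E F : U.Bundle) : Hom E F where
  mat _ := 0
  mat_reg _ _ _ := zero_mem _
  mat_homog _ _ _ := zero_mem _
  comm _ _ := by rw [Matrix.zero_mul, Matrix.mul_zero]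

theorem cls_eq_zero {E : U.Bundle} (h : E.rank = 0) : cls E = 0 := by
  have : IsEmpty (Fin E.rank) := by rw [h]; infer_instance
  have := cls_exact (zeroHom E E) (zeroHom E E) fun i =>
    ⟨0, 0, fun _ _ => zero_mem _, fun _ _ => zero_mem _, Subsingleton.elim _ _,
      Subsingleton.elim _ _, Subsingleton.elim _ _⟩
  simpa using this

/-- The bundle of rank zero. -/
def zeroBundle (U : Charts Γ I) : U.Bundle where
  rank := 0
  wt _ _ := 0
  trans _ _ := 1
  trans_self _ := rfl
  trans_mul _ _ _ := one_mul _
  trans_reg _ _ a := a.elim0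
  trans_homog _ _ a := a.elim0

/-- Isomorphic bundles have the same class. Regularity of the inverse on each chart suffices, since
exactness is a condition on the underlying non-equivariant bundles. -/
theorem cls_eq_of_iso {E F : U.Bundle} (u : Hom E F)
    (s : I → Matrix (Fin E.rank) (Fin F.rank) (TorusAlg Γ)) (hs : ∀ i a b, s i a b ∈ U.reg i)
    (h1 : ∀ i, u.mat i * s i = 1) (h2 : ∀ i, s i * u.mat i = 1) : cls E = cls F := by
  have := cls_exact (zeroHom (zeroBundle U) E) u fun i =>
    ⟨0, s i, fun _ _ => zero_mem _, hs i,
      by ext a; exact a.elim0, h1 i, by rw [Matrix.mul_zero, zero_add, h2]⟩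
  rw [this, cls_eq_zero (E := zeroBundle U) rfl, zero_add]

/-- A bundle all of whose transition functions are block upper triangular is, in K-theory, the sum
of its diagonal blocks. The bijections `σ i` split the frame over the chart `i` into the
two blocks. -/
theorem cls_eq_add {E E' E'' : U.Bundle} (σ : I → Fin E'.rank ⊕ Fin E''.rank ≃ Fin E.rank)
    (w1 : ∀ i a, E.wt i (σ i (.inl a)) = E'.wt i a)
    (w2 : ∀ i a, E.wt i (σ i (.inr a)) = E''.wt i a)
    (t11 : ∀ i j a b, E.trans i j (σ i (.inl a)) (σ j (.inl b)) = E'.trans i j a b)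
    (t22 : ∀ i j a b, E.trans i j (σ i (.inr a)) (σ j (.inr b)) = E''.trans i j a b)
    (t21 : ∀ i j a b, E.trans i j (σ i (.inr a)) (σ j (.inl b)) = 0) :
    cls E = cls E' + cls E'' := by
  classical
  refine cls_exact
    { mat := fun i => (1 : Matrix _ _ (TorusAlg Γ)).submatrix id (σ i ∘ Sum.inl)
      mat_reg := fun i a b => one_apply_mem_reg i _ _
      mat_homog := fun i a b => by rw [← w1]; exact one_apply_mem_homog (E.wt i) _ _
      comm := fun i j => ?_ }
    { mat := fun i => (1 : Matrix _ _ (TorusAlg Γ)).submatrix (σ i ∘ Sum.inr) id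
      mat_reg := fun i a b => one_apply_mem_reg i _ _
      mat_homog := fun i a b => by rw [← w2]; exact one_apply_mem_homog (E.wt i) _ _
      comm := fun i j => ?_ } ?_
  · ext1 a b
    obtain ⟨a, rfl⟩ := (σ i).surjective a
    rw [Matrix.mul_apply, Matrix.mul_apply, ← (σ j).sum_comp, Fintype.sum_sum_type]
    rcases a with a | a
    · simp [Matrix.one_apply, t11]
    · simp [Matrix.one_apply, t21]
  · ext1 a b
    obtain ⟨b, rfl⟩ := (σ j).surjective b
    rw [Matrix.mul_apply, Matrix.mul_apply, ← (σ i).sum_comp, Fintype.sum_sum_type]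
    rcases b with b | b
    · simp [Matrix.one_apply, t21]
    · simp [Matrix.one_apply, t22]
  · intro i
    refine ⟨(1 : Matrix _ _ (TorusAlg Γ)).submatrix (σ i ∘ Sum.inl) id,
      (1 : Matrix _ _ (TorusAlg Γ)).submatrix id (σ i ∘ Sum.inr),
      fun a b => one_apply_mem_reg i _ _, fun a b => one_apply_mem_reg i _ _, ?_, ?_, ?_⟩
    · ext1 a b
      simp [Matrix.mul_apply, Matrix.one_apply]
    · ext1 a b
      simp [Matrix.mul_apply, Matrix.one_apply]
    · ext1 a b
      rw [Matrix.add_apply, Matrix.mul_apply, Matrix.mul_apply]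
      obtain ⟨a, rfl⟩ := (σ i).surjective a
      obtain ⟨b, rfl⟩ := (σ i).surjective b
      rcases a with a | a <;> rcases b with b | b <;> simp [Matrix.one_apply]

/-- Bundles of rank one whose transition functions differ by invertible functions on the charts have
the same class. -/
theorem cls_eq_of_line_iso {E F : U.Bundle} (hE : E.rank = 1) (hF : F.rank = 1)
    (m m' : I → TorusAlg Γ) (hm : ∀ i, m i ∈ U.reg i) (hm' : ∀ i, m' i ∈ U.reg i)
    (hmm : ∀ i, m i * m' i = 1) (hw : ∀ i a b, m i ∈ U.homog (F.wt i a - E.wt i b))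
    (ht : ∀ i j a b c d, m i * E.trans i j a b = F.trans i j c d * m j) : cls E = cls F := by
  have : Unique (Fin E.rank) := hE ▸ inferInstanceAs (Unique (Fin 1))
  have : Unique (Fin F.rank) := hF ▸ inferInstanceAs (Unique (Fin 1))
  refine cls_eq_of_iso
    { mat := fun i => Matrix.of fun _ _ => m i
      mat_reg := fun i _ _ => hm i
      mat_homog := fun i a b => hw i a b
      comm := fun i j => ?_ } (fun i => Matrix.of fun _ _ => m' i) (fun i _ _ => hm' i)
    (fun i => ?_) fun i => ?_
  · ext1 a b
    simpa [Matrix.mul_apply] using ht i j default b a default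
  · ext1 a b
    rw [Subsingleton.elim a b, Matrix.one_apply_eq, Matrix.mul_apply]
    simp [hmm]
  · ext1 a b
    rw [Subsingleton.elim a b, Matrix.one_apply_eq, Matrix.mul_apply]
    simp [mul_comm, hmm]

theorem char_trans_apply (w : ℤ) (i j : I) (a b) : (U.char w).trans i j a b = 1 := by
  rw [Subsingleton.elim (α := Fin 1) a b]
  exact Matrix.one_apply_eq _

/-- A bundle of rank one with trivial transition functions is a character. -/
theorem cls_eq_charCls {E : U.Bundle} {w : ℤ} (hr : E.rank = 1) (hw : ∀ i a, E.wt i a = w)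
    (ht : ∀ i j, E.trans i j = 1) : cls E = U.charCls w := by
  have : Subsingleton (Fin E.rank) := by rw [hr]; infer_instance
  refine cls_eq_of_line_iso hr rfl (fun _ => 1) (fun _ => 1) one_mem_reg one_mem_reg
    (fun _ => one_mul 1) (fun i a b => one_mem_homog (by rw [hw]; exact sub_self w))
    fun i j a b c d => ?_
  rw [char_trans_apply, ht, Subsingleton.elim a b, Matrix.one_apply_eq]

theorem charCls_add (v w : ℤ) : U.charCls (v + w) = U.charCls v * U.charCls w := by
  change cls _ = cls _ * cls _
  rw [← cls_tensor]
  exact (cls_eq_charCls rfl (fun _ _ => rfl) fun i j => by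
    ext1 a b
    have hs : Subsingleton (Fin (tensor (U.char v) (U.char w)).rank) :=
      inferInstanceAs (Subsingleton (Fin 1))
    obtain rfl := Subsingleton.elim a b
    rw [Matrix.one_apply_eq]
    change (1 : Matrix (Fin 1) (Fin 1) (TorusAlg Γ)) _ _ *
      (1 : Matrix (Fin 1) (Fin 1) (TorusAlg Γ)) _ _ = 1
    exact (congrArg₂ _ (Matrix.one_apply_eq _) (Matrix.one_apply_eq _)).trans (one_mul 1)).symm

theorem charCls_nsmul (k : ℕ) (w : ℤ) : U.charCls (k * w) = U.charCls w ^ k := by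
  induction k with
  | zero => simp [charCls_zero]
  | succ k ih => rw [pow_succ, ← ih, ← charCls_add]; congr 1; push_cast; ring

/-- The characters span a subspace closed under products. -/
theorem span_charCls_mul {x y : U.KTheory} (hx : x ∈ Submodule.span ℂ (Set.range U.charCls))
    (hy : y ∈ Submodule.span ℂ (Set.range U.charCls)) :
    x * y ∈ Submodule.span ℂ (Set.range U.charCls) := by
  have h := Submodule.mul_mem_mul hx hy
  rw [Submodule.span_mul_span] at h
  refine Submodule.span_mono ?_ h
  rintro _ ⟨_, ⟨v, rfl⟩, _, ⟨w, rfl⟩, rfl⟩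
  exact ⟨v + w, charCls_add v w⟩

/-- If every bundle is, in K-theory, a combination of characters, then the characters
span. -/
theorem span_charCls_eq_top
    (h : ∀ E : U.Bundle, cls E ∈ Submodule.span ℂ (Set.range U.charCls)) :
    Submodule.span ℂ (Set.range U.charCls) = ⊤ := by
  rw [eq_top_iff]
  rintro x -
  obtain ⟨p, rfl⟩ := Ideal.Quotient.mk_surjective x
  induction p using MvPolynomial.induction_on with
  | C a =>
    have : (Ideal.Quotient.mk _ (MvPolynomial.C a) : U.KTheory) = a • U.charCls 0 := by
      rw [charCls_zero]
      exact Algebra.algebraMap_eq_smul_one (A := U.KTheory) a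
    rw [this]
    exact Submodule.smul_mem _ _ (Submodule.subset_span ⟨0, rfl⟩)
  | add p q hp hq => rw [map_add]; exact add_mem hp hq
  | mul_X p E hp => rw [map_mul]; exact span_charCls_mul hp (h E)

/-! ### Adams operations on characters -/

theorem cls_exterior_char_one (w : ℤ) : cls (exterior 1 (U.char w)) = U.charCls w := by
  refine cls_eq_charCls rfl (fun i a => ?_) fun i j => ?_
  · change ∑ x ∈ _, w = w
    rw [Finset.sum_const, Set.powersetCard.mem_iff.1 (Subtype.property _), one_smul]
  · exact (exterior 1 (U.char w)).trans_self i

theorem cls_exterior_char (w : ℤ) (k : ℕ) : cls (exterior (k + 2) (U.char w)) = 0 :=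
  cls_eq_zero (Nat.choose_eq_zero_of_lt (by simp [char]))

/-- If `λⁱ = 0` for `i ≥ 2`, as for a line bundle, then `ψᵏ` is the `k`-th power of `λ¹`. -/
theorem newton_eq_pow {R : Type} [CommRing R] (lam : ℕ → R) (h : ∀ i, lam (i + 2) = 0) (k : ℕ) :
    newton lam (k + 1) = lam 1 ^ (k + 1) := by
  induction k with
  | zero => rw [newton]; simp
  | succ k ih =>
    rw [newton, h, mul_zero, zero_add]
    change ∑ i : Fin (k + 1), (-1 : R) ^ (i : ℕ) * lam (i + 1) * newton lam (k + 1 - i) = _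
    rw [Fin.sum_univ_succ, Finset.sum_eq_zero]
    · simp only [Fin.val_zero, pow_zero, one_mul, zero_add, add_zero, Nat.sub_zero]
      rw [ih, ← pow_succ']
    · intro i _
      rw [Fin.val_succ, h, mul_zero, zero_mul]

theorem adamsCls_char (w : ℤ) (k : ℕ) :
    adamsCls (k + 1) (U.char w) = U.charCls ((k + 1 : ℕ) * w) := by
  rw [charCls_nsmul, ← cls_exterior_char_one]
  exact newton_eq_pow _ (cls_exterior_char w) k

theorem charCls_mem_adamsGraph {k : ℕ} (hk : 1 ≤ k) (w : ℤ) :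
    (U.charCls w, U.charCls (k * w)) ∈ U.adamsGraph k := by
  obtain ⟨k, rfl⟩ := Nat.exists_eq_add_of_le' hk
  rw [← adamsCls_char]
  exact Submodule.subset_span ⟨U.char w, rfl⟩

/-! ### Filtering and reframing bundles -/

theorem mul_apply_mem {R m n o : Type} [Ring R] [Fintype n] [Algebra ℂ R] {S : Submodule ℂ R}
    {A : Matrix m n R} {B : Matrix n o R} {a : m} {b : o} (h : ∀ c, A a c * B c b ∈ S) :
    (A * B) a b ∈ S := by
  rw [Matrix.mul_apply]
  exact sum_mem fun c _ => h c

section Blocks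

variable (E : U.Bundle) {p q : ℕ} (σ : I → Fin p ⊕ Fin q ≃ Fin E.rank)
  (h : ∀ i j a b, E.trans i j (σ i (.inr a)) (σ j (.inl b)) = 0)

/-- The subbundle spanned by the first block of each frame, when the transition functions are
block upper triangular. -/
def subBundle : U.Bundle where
  rank := p
  wt i a := E.wt i (σ i (.inl a))
  trans i j := (E.trans i j).submatrix (σ i ∘ Sum.inl) (σ j ∘ Sum.inl)
  trans_self i := by
    rw [E.trans_self, Matrix.submatrix_one _ ((σ i).injective.comp Sum.inl_injective)]
  trans_mul i j k := by
    ext1 a b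
    rw [Matrix.submatrix_apply, ← E.trans_mul i j k, Matrix.mul_apply, Matrix.mul_apply,
      ← (σ j).sum_comp, Fintype.sum_sum_type]
    simp [h]
  trans_reg i j _ _ := E.trans_reg i j _ _
  trans_homog i j _ _ := E.trans_homog i j _ _

/-- The quotient of a bundle by the subbundle spanned by the first block of each frame. -/
def quotBundle : U.Bundle where
  rank := q
  wt i a := E.wt i (σ i (.inr a))
  trans i j := (E.trans i j).submatrix (σ i ∘ Sum.inr) (σ j ∘ Sum.inr)
  trans_self i := by
    rw [E.trans_self, Matrix.submatrix_one _ ((σ i).injective.comp Sum.inr_injective)]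
  trans_mul i j k := by
    ext1 a b
    rw [Matrix.submatrix_apply, ← E.trans_mul i j k, Matrix.mul_apply, Matrix.mul_apply,
      ← (σ j).sum_comp, Fintype.sum_sum_type]
    simp [h]
  trans_reg i j _ _ := E.trans_reg i j _ _
  trans_homog i j _ _ := E.trans_homog i j _ _

theorem cls_eq_sub_add_quot : cls E = cls (subBundle E σ h) + cls (quotBundle E σ h) :=
  cls_eq_add (E' := subBundle E σ h) (E'' := quotBundle E σ h) σ (fun _ _ => rfl)
    (fun _ _ => rfl) (fun _ _ _ _ => rfl) (fun _ _ _ _ => rfl) h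

end Blocks

theorem exists_split_at {m r : ℕ} (hr : m = r + 1) (a : Fin m) :
    ∃ σ : Fin 1 ⊕ Fin r ≃ Fin m, σ (.inl 0) = a := by
  let e : Fin 1 ⊕ Fin r ≃ Fin m := finSumFinEquiv.trans (finCongr (by omega))
  exact ⟨e.trans (Equiv.swap (e (.inl 0)) a), by simp⟩

/-- Change of the frames of a bundle, by invertible regular matrices of degree zero. -/
def reframe (E : U.Bundle) (g h : I → Matrix (Fin E.rank) (Fin E.rank) (TorusAlg Γ))
    (gh : ∀ i, g i * h i = 1) (hg : ∀ i, h i * g i = 1)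
    (greg : ∀ i a b, g i a b ∈ U.reg i) (hreg : ∀ i a b, h i a b ∈ U.reg i)
    (ghom : ∀ i a b, g i a b ∈ U.homog (E.wt i a - E.wt i b))
    (hhom : ∀ i a b, h i a b ∈ U.homog (E.wt i a - E.wt i b)) : U.Bundle where
  rank := E.rank
  wt := E.wt
  trans i j := g i * E.trans i j * h j
  trans_self i := by rw [E.trans_self, Matrix.mul_one, gh]
  trans_mul i j k := by
    rw [← E.trans_mul i j k]
    simp only [Matrix.mul_assoc]
    rw [← Matrix.mul_assoc (h j) (g j), hg, Matrix.one_mul]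
  trans_reg i j a b := mul_apply_mem fun c => mul_mem_regOn
    (mul_apply_mem fun d => mul_mem_regOn (reg_le_regOn_left i j (greg i a d))
      (E.trans_reg i j d c)) (reg_le_regOn_right i j (hreg j c b))
  trans_homog i j a b := mul_apply_mem fun c => mul_mem_homog (sub_add_sub_cancel _ _ _)
    (mul_apply_mem fun d => mul_mem_homog (sub_add_sub_cancel _ _ _) (ghom i a d)
      (E.trans_homog i j d c)) (hhom j c b)

theorem cls_reframe (E : U.Bundle) (g h : I → Matrix (Fin E.rank) (Fin E.rank) (TorusAlg Γ))
    (gh : ∀ i, g i * h i = 1) (hg : ∀ i, h i * g i = 1)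
    (greg : ∀ i a b, g i a b ∈ U.reg i) (hreg : ∀ i a b, h i a b ∈ U.reg i)
    (ghom : ∀ i a b, g i a b ∈ U.homog (E.wt i a - E.wt i b))
    (hhom : ∀ i a b, h i a b ∈ U.homog (E.wt i a - E.wt i b)) :
    cls E = cls (reframe E g h gh hg greg hreg ghom hhom) :=
  cls_eq_of_iso (F := reframe E g h gh hg greg hreg ghom hhom)
    { mat := g
      mat_reg := greg
      mat_homog := ghom
      comm := fun i j => by
        change _ = g i * E.trans i j * h j * g j
        rw [Matrix.mul_assoc _ (h j), hg, Matrix.mul_one]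
        rfl } h hreg gh hg

end Charts

/-! ### The equivariant K-theory of `Z` -/

open Charts

variable {n : ℕ}

theorem cls_line_mem_span (E : (lineCharts n).Bundle) :
    cls E ∈ Submodule.span ℂ (Set.range (lineCharts n).charCls) := by
  induction hr : E.rank generalizing E with
  | zero => rw [cls_eq_zero hr]; exact zero_mem _
  | succ r ih =>
    obtain ⟨σ, -⟩ := exists_split_at hr ⟨0, by omega⟩
    have ht : ∀ i j, E.trans i j = 1 := fun i j => E.trans_self i
    have h : ∀ i j a b, E.trans i j (σ (.inr a)) (σ (.inl b)) = 0 := fun i j a b => by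
      rw [ht, Matrix.one_apply_ne (by simp)]
    rw [cls_eq_sub_add_quot E (fun _ => σ) h]
    refine add_mem ?_ (ih _ rfl)
    rw [cls_eq_charCls (E := subBundle E (fun _ => σ) h) (w := E.wt () (σ (.inl 0))) rfl]
    · exact Submodule.subset_span ⟨_, rfl⟩
    · intro i a
      change E.wt i (σ (.inl a)) = _
      rw [Subsingleton.elim (α := Fin 1) a 0]
    · exact fun i j => (subBundle E (fun _ => σ) h).trans_self i

theorem span_charCls_line : Submodule.span ℂ (Set.range (lineCharts n).charCls) = ⊤ :=
  span_charCls_eq_top cls_line_mem_span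

/-- The coordinate `z₂` trivializes the character of weight `n` on `Z`. -/
theorem charCls_line_self : (lineCharts n).charCls n = 1 := by
  rw [← charCls_zero]
  refine (cls_eq_of_line_iso (E := (lineCharts n).char 0) (F := (lineCharts n).char n) rfl rfl
    (fun _ => .single (1 : ℤ) 1) (fun _ => .single (-1 : ℤ) 1)
    (fun _ => single_mem_reg (AddSubmonoid.mem_top _) _)
    (fun _ => single_mem_reg (AddSubmonoid.mem_top _) _)
    (fun _ => by simp only [AddMonoidAlgebra.single_mul_single, AddMonoidAlgebra.one_def,
      add_neg_cancel, mul_one])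
    (fun _ _ _ => single_mem_homog (by simp [lineCharts, char]) _) fun i j a b c d => ?_).symm
  rw [char_trans_apply, char_trans_apply, mul_comm]

/-! ### The equivariant K-theory of `X` -/

/-- The units of the group algebra of `ℤ × ℤ` are monomials. -/
theorem exists_eq_single_of_mul_eq_one {f g : TorusAlg (ℤ × ℤ)} (h : f * g = 1) :
    ∃ γ c, c ≠ 0 ∧ f = .single γ c := by
  classical
  have hfg : f ≠ 0 ∧ g ≠ 0 := by
    constructor <;> rintro rfl <;> simp at h
  have hf : 0 < f.coeff.support.card := by
    rw [Finset.card_pos, Finsupp.support_nonempty_iff]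
    exact fun h0 => hfg.1 (AddMonoidAlgebra.ext h0)
  have hg : 0 < g.coeff.support.card := by
    rw [Finset.card_pos, Finsupp.support_nonempty_iff]
    exact fun h0 => hfg.2 (AddMonoidAlgebra.ext h0)
  have h1 : f.coeff.support.card = 1 := by
    by_contra hne
    have hlt : 1 < f.coeff.support.card * g.coeff.support.card := by
      have : 2 ≤ f.coeff.support.card := by omega
      nlinarith
    obtain ⟨p, hp, q, hq, hpq, up, uq⟩ := TwoUniqueSums.uniqueAdd_of_one_lt_card hlt
    rw [Finset.mem_product] at hp hq
    have hz : ∀ p : (ℤ × ℤ) × (ℤ × ℤ), p.1 ∈ f.coeff.support → p.2 ∈ g.coeff.support →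
        UniqueAdd f.coeff.support g.coeff.support p.1 p.2 → p.1 + p.2 = 0 := by
      intro p h1 h2 up
      by_contra h0
      have h3 := AddMonoidAlgebra.coeff_mul_add_of_uniqueAdd up
      rw [h, AddMonoidAlgebra.one_def, AddMonoidAlgebra.coeff_single,
        Finsupp.single_eq_of_ne h0] at h3
      exact mul_ne_zero (Finsupp.mem_support_iff.1 h1) (Finsupp.mem_support_iff.1 h2) h3.symm
    have := up hq.1 hq.2 ((hz q hq.1 hq.2 uq).trans (hz p hp.1 hp.2 up).symm)
    exact hpq (Prod.ext this.1 this.2).symm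
  obtain ⟨γ, c, hc, h2⟩ := Finsupp.card_support_eq_one'.1 h1
  exact ⟨γ, c, hc, AddMonoidAlgebra.ext h2⟩

theorem mem_plane_chart_zero {γ : ℤ × ℤ} : γ ∈ (planeCharts n).chart 0 ↔ 0 ≤ γ.2 := Iff.rfl

theorem mem_plane_chart_one {γ : ℤ × ℤ} : γ ∈ (planeCharts n).chart 1 ↔ 0 ≤ γ.1 := Iff.rfl

theorem plane_deg (γ : ℤ × ℤ) : (planeCharts n).deg γ = γ.1 + n * γ.2 := by
  simp [planeCharts]

/-- A line bundle on `X` is a character: its transition function is a monomial `c z₁ⁱ z₂ʲ`, and `z₁`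
and `z₂` are invertible on the respective charts. -/
theorem cls_plane_mem_range {E : (planeCharts n).Bundle} (hr : E.rank = 1) :
    ∃ w, cls E = (planeCharts n).charCls w := by
  obtain ⟨rank, wt, trans, tself, tmul, treg, thom⟩ := E
  obtain rfl : rank = 1 := hr
  have h01 : trans 0 1 0 0 * trans 1 0 0 0 = 1 := by
    have := congrFun₂ ((tmul 0 1 0).trans (tself 0)) 0 0
    simpa [Matrix.mul_apply] using this
  obtain ⟨γ, c, hc, hγ⟩ := exists_eq_single_of_mul_eq_one h01
  have hdeg : γ.1 + n * γ.2 = wt 0 0 - wt 1 0 := by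
    rw [← plane_deg]
    have := thom 0 1 0 0
    rw [hγ] at this
    exact mem_funcs.1 this γ (by simpa using hc)
  let m : Fin 2 → TorusAlg (ℤ × ℤ) := ![.single (-γ.1, 0) c⁻¹, .single (0, γ.2) 1]
  let m' : Fin 2 → TorusAlg (ℤ × ℤ) := ![.single (γ.1, 0) c, .single (0, -γ.2) 1]
  have hmm : ∀ i, m i * m' i = 1 := by
    rw [Fin.forall_fin_two]
    simp [m, m', AddMonoidAlgebra.single_mul_single, AddMonoidAlgebra.one_def, hc,
      Prod.mk_zero_zero]
  have hcomm : ∀ i j, m i * trans i j 0 0 = m j := by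
    have hs : ∀ i, trans i i 0 0 = 1 := fun i => by rw [tself, Matrix.one_apply_eq]
    have h0 : m 0 * trans 0 1 0 0 = m 1 := by
      rw [hγ]
      have : (-γ.1, 0) + γ = (0, γ.2) := by ext <;> simp
      simp [m, AddMonoidAlgebra.single_mul_single, hc, this]
    rw [Fin.forall_fin_two]
    constructor <;> rw [Fin.forall_fin_two]
    · exact ⟨by rw [hs, mul_one], h0⟩
    · exact ⟨by rw [← h0, mul_assoc, h01, mul_one], by rw [hs, mul_one]⟩
  refine ⟨wt 1 0 + n * γ.2, cls_eq_of_line_iso rfl rfl m m' ?_ ?_ hmm ?_ ?_⟩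
  · rw [Fin.forall_fin_two]
    exact ⟨single_mem_reg (mem_plane_chart_zero.2 le_rfl) _,
      single_mem_reg (mem_plane_chart_one.2 le_rfl) _⟩
  · rw [Fin.forall_fin_two]
    exact ⟨single_mem_reg (mem_plane_chart_zero.2 le_rfl) _,
      single_mem_reg (mem_plane_chart_one.2 le_rfl) _⟩
  · rw [Fin.forall_fin_two]
    refine ⟨fun a b => single_mem_homog ?_ _, fun a b => single_mem_homog ?_ _⟩
    · rw [plane_deg, Subsingleton.elim (α := Fin 1) b 0]
      change -γ.1 + n * 0 = wt 1 0 + n * γ.2 - wt 0 0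
      linarith
    · rw [plane_deg, Subsingleton.elim (α := Fin 1) b 0]
      change 0 + n * γ.2 = wt 1 0 + n * γ.2 - wt 1 0
      linarith
  · intro i j a b c d
    rw [char_trans_apply, one_mul, Subsingleton.elim (α := Fin 1) a 0,
      Subsingleton.elim (α := Fin 1) b 0]
    exact hcomm i j

/-- The largest `z₂`-degree of a monomial of `f`, shifted by `N + 1` and zero for `f = 0`. The shift
makes it positive for `f ≠ 0` when all exponents of `z₂` are at least `-N`. -/
def width (N : ℤ) (f : TorusAlg (ℤ × ℤ)) : ℕ := f.coeff.support.sup fun γ => (γ.2 + N + 1).toNat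

/-- The functions all of whose monomials have `z₂`-degree at least `-N`. -/
def bddBelow (N : ℤ) : Submodule ℂ (TorusAlg (ℤ × ℤ)) := funcs {γ | -N ≤ γ.2}

/-- Division with remainder: for homogeneous `f`, `g` with `width g ≤ width f`, subtracting from `f`
the product of `g` with a monomial regular for `z₁ ≠ 0` makes `f` narrower. -/
theorem exists_width_sub_lt {N p q : ℤ} {f g : TorusAlg (ℤ × ℤ)} (hf0 : f ≠ 0) (hg0 : g ≠ 0)
    (hf : f ∈ (planeCharts n).homog p) (hg : g ∈ (planeCharts n).homog q)
    (hfN : f ∈ bddBelow N) (hgN : g ∈ bddBelow N) (hle : width N g ≤ width N f) :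
    ∃ m ∈ (planeCharts n).reg 0, m ∈ (planeCharts n).homog (p - q) ∧
      f - m * g ∈ bddBelow N ∧ width N (f - m * g) < width N f := by
  classical
  have top : ∀ f : TorusAlg (ℤ × ℤ), f ≠ 0 → f ∈ bddBelow N → ∃ γ, f.coeff γ ≠ 0 ∧
      (width N f : ℤ) = γ.2 + N + 1 ∧ ∀ δ, f.coeff δ ≠ 0 → δ.2 ≤ γ.2 := by
    intro f hf0 hfN
    have hne : f.coeff.support.Nonempty := by
      rw [Finsupp.support_nonempty_iff]
      exact fun h0 => hf0 (AddMonoidAlgebra.ext h0)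
    obtain ⟨γ, hγ, hmax⟩ := Finset.exists_max_image _ (fun γ : ℤ × ℤ => γ.2) hne
    have hγ0 := Finsupp.mem_support_iff.1 hγ
    have hγN : -N ≤ γ.2 := mem_funcs.1 hfN γ hγ0
    refine ⟨γ, hγ0, ?_, fun δ hδ => hmax δ (Finsupp.mem_support_iff.2 hδ)⟩
    have : width N f = (γ.2 + N + 1).toNat := by
      refine le_antisymm (Finset.sup_le fun δ hδ => Int.toNat_le_toNat ?_)
        (Finset.le_sup (f := fun γ : ℤ × ℤ => (γ.2 + N + 1).toNat) hγ)
      linarith [hmax δ hδ]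
    rw [this, Int.toNat_of_nonneg (by linarith)]
  obtain ⟨γ, hγ0, hγw, hγmax⟩ := top f hf0 hfN
  obtain ⟨δ, hδ0, hδw, hδmax⟩ := top g hg0 hgN
  have hδγ : δ.2 ≤ γ.2 := by have : (width N g : ℤ) ≤ width N f := by exact_mod_cast hle
                             linarith
  have hdγ : (planeCharts n).deg γ = p := mem_funcs.1 hf γ hγ0
  have hdδ : (planeCharts n).deg δ = q := mem_funcs.1 hg δ hδ0
  let m : TorusAlg (ℤ × ℤ) := .single (γ - δ) (f.coeff γ / g.coeff δ)
  have hm : m ∈ (planeCharts n).homog (p - q) := single_mem_homog (by rw [map_sub, hdγ, hdδ]) _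
  have hmg : ∀ ε, (m * g).coeff ε = f.coeff γ / g.coeff δ * g.coeff (ε - (γ - δ)) := by
    intro ε
    exact AddMonoidAlgebra.coeff_single_mul_eq_mul_coeff _ fun δ' _ => (eq_sub_iff_add_eq'.symm)
  have hbdd : f - m * g ∈ bddBelow N := by
    refine sub_mem hfN (mem_funcs.2 fun ε hε => ?_)
    rw [hmg] at hε
    have : -N ≤ (ε - (γ - δ)).2 := mem_funcs.1 hgN _ (right_ne_zero_of_mul hε)
    simp only [Prod.snd_sub] at this
    change -N ≤ ε.2
    linarith
  have hhom : f - m * g ∈ (planeCharts n).homog p :=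
    sub_mem hf (mul_mem_homog (sub_add_cancel _ _) hm hg)
  refine ⟨m, single_mem_reg (mem_plane_chart_zero.2 (by simpa using hδγ)) _, hm, hbdd, ?_⟩
  have hpos : 0 < width N f := by
    have : -N ≤ γ.2 := mem_funcs.1 hfN γ hγ0
    omega
  refine (Finset.sup_lt_iff hpos).2 fun ε hε => ?_
  have hε0 := Finsupp.mem_support_iff.1 hε
  have hεd : (planeCharts n).deg ε = p := mem_funcs.1 hhom ε hε0
  have hεN : -N ≤ ε.2 := mem_funcs.1 hbdd ε hε0
  have hle : ε.2 ≤ γ.2 := by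
    rw [AddMonoidAlgebra.coeff_sub, Finsupp.sub_apply, hmg] at hε0
    by_cases h : f.coeff ε = 0
    · rw [h, zero_sub, neg_ne_zero] at hε0
      have := hδmax _ (right_ne_zero_of_mul hε0)
      simp only [Prod.snd_sub] at this
      linarith
    · exact hγmax ε h
  have hne : ε.2 ≠ γ.2 := by
    intro h
    -- on homogeneous functions the exponent of `z₂` determines the monomial
    have hεγ : ε = γ := by
      rw [plane_deg] at hεd hdγ
      refine Prod.ext ?_ h
      rw [h] at hεd
      linarith
    apply hε0
    rw [AddMonoidAlgebra.coeff_sub, Finsupp.sub_apply, hmg, hεγ, sub_sub_cancel,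
      div_mul_cancel₀ _ hδ0, sub_self]
  omega

theorem transvection_apply_mem {R m : Type} [Ring R] [Algebra ℂ R] [DecidableEq m]
    {S : m → m → Submodule ℂ R} (h1 : ∀ a b, (1 : Matrix m m R) a b ∈ S a b) {a b : m} {c : R}
    (hc : c ∈ S a b) (a' b' : m) :
    (1 + Matrix.single a b c) a' b' ∈ S a' b' := by
  rw [Matrix.add_apply, Matrix.single_apply]
  split_ifs with h
  · exact add_mem (h1 _ _) (by rw [← h.1, ← h.2]; exact hc)
  · rw [add_zero]; exact h1 _ _

/-- Adding `m` times the `b`-th row to the `a`-th row of the transition function from the chart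
`z₂ ≠ 0` to the chart `z₁ ≠ 0`, for `m` regular on the latter and of the appropriate degree, does
not change the class of a bundle. -/
theorem exists_row_operation (E : (planeCharts n).Bundle) {a b : Fin E.rank} (hab : a ≠ b)
    {m : TorusAlg (ℤ × ℤ)} (hm : m ∈ (planeCharts n).reg 0)
    (hmd : m ∈ (planeCharts n).homog (E.wt 0 a - E.wt 0 b)) :
    ∃ (F : (planeCharts n).Bundle) (h : F.rank = E.rank), cls F = cls E ∧
      ∀ c d, F.trans 0 1 c d =
        (Matrix.transvection a b m * E.trans 0 1) (Fin.cast h c) (Fin.cast h d) := by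
  have key : ∀ m ∈ (planeCharts n).reg 0, m ∈ (planeCharts n).homog (E.wt 0 a - E.wt 0 b) →
      (∀ (i : Fin 2) c d, (![Matrix.transvection a b m, 1] : Fin 2 → Matrix _ _ _) i c d ∈
        (planeCharts n).reg i) ∧
      (∀ (i : Fin 2) c d, (![Matrix.transvection a b m, 1] : Fin 2 → Matrix _ _ _) i c d ∈
        (planeCharts n).homog (E.wt i c - E.wt i d)) := by
    intro m hm hmd
    constructor <;> rw [Fin.forall_fin_two]
    · exact ⟨transvection_apply_mem (one_apply_mem_reg 0) hm, one_apply_mem_reg 1⟩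
    · exact ⟨transvection_apply_mem (S := fun c d => (planeCharts n).homog (E.wt 0 c - E.wt 0 d))
        (one_apply_mem_homog (E.wt 0)) hmd, one_apply_mem_homog (E.wt 1)⟩
  have inv : ∀ m, ∀ i : Fin 2, (![Matrix.transvection a b m, 1] : Fin 2 → Matrix _ _ _) i *
      (![Matrix.transvection a b (-m), 1] : Fin 2 → Matrix _ _ (TorusAlg (ℤ × ℤ))) i = 1 := by
    intro m
    rw [Fin.forall_fin_two]
    refine ⟨?_, one_mul 1⟩
    change Matrix.transvection a b m * Matrix.transvection a b (-m) = 1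
    rw [Matrix.transvection_mul_transvection_same _ _ hab, add_neg_cancel,
      Matrix.transvection_zero]
  obtain ⟨h1, h2⟩ := key m hm hmd
  obtain ⟨h3, h4⟩ := key (-m) (neg_mem hm) (neg_mem hmd)
  refine ⟨reframe E _ _ (inv m) (by simpa using inv (-m)) h1 h3 h2 h4, rfl,
    (cls_reframe ..).symm, fun c d => ?_⟩
  exact congrFun₂ (Matrix.mul_one (Matrix.transvection a b m * E.trans 0 1)) c d

/-- By induction on the rank, and on the total width of the first column of the transition function
to the chart `z₁ ≠ 0`: if two entries are nonzero, a row operation narrows the wider one; a single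
nonzero entry yields a line subbundle. -/
theorem cls_plane_mem_span (E : (planeCharts n).Bundle) :
    cls E ∈ Submodule.span ℂ (Set.range (planeCharts n).charCls) := by
  classical
  induction hr : E.rank generalizing E with
  | zero => rw [cls_eq_zero hr]; exact zero_mem _
  | succ r ih =>
  have hbdd : ∀ {ι : Type} [Fintype ι] (f : ι → TorusAlg (ℤ × ℤ)), ∃ N, ∀ a, f a ∈ bddBelow N := by
    intro ι _ f
    obtain ⟨N, hN⟩ := ((Finset.univ : Finset ι).biUnion fun a => (f a).coeff.support.image
      fun γ => -γ.2).bddAbove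
    refine ⟨N, fun a => mem_funcs.2 fun γ hγ => neg_le.1 (hN ?_)⟩
    simp only [Finset.coe_biUnion, Set.mem_iUnion]
    exact ⟨a, Finset.mem_coe.2 (Finset.mem_univ a), Finset.mem_coe.2 (Finset.mem_image_of_mem _
      (Finsupp.mem_support_iff.2 hγ))⟩
  let b₀ : ∀ E : (planeCharts n).Bundle, E.rank = r + 1 → Fin E.rank := fun E hr => ⟨0, by omega⟩
  obtain ⟨N, hN⟩ := hbdd fun a => E.trans 0 1 a (b₀ E hr)
  generalize hk : ∑ a, width N (E.trans 0 1 a (b₀ E hr)) = k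
  induction k using Nat.strong_induction_on generalizing E with
  | _ k ihk =>
  set f := fun a => E.trans 0 1 a (b₀ E hr) with hf
  by_cases h : ∃ a b, a ≠ b ∧ f a ≠ 0 ∧ f b ≠ 0 ∧ width N (f b) ≤ width N (f a)
  · obtain ⟨a, b, hab, ha, hb, hle⟩ := h
    obtain ⟨m, hm, hmd, hmN, hmw⟩ := exists_width_sub_lt ha hb (E.trans_homog 0 1 a _)
      (E.trans_homog 0 1 b _) (hN a) (hN b) hle
    rw [sub_sub_sub_cancel_right] at hmd
    obtain ⟨F, hF, hcls, htF⟩ := exists_row_operation E hab (neg_mem hm) (neg_mem hmd)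
    set t := Matrix.transvection a b (-m) * E.trans 0 1 with ht
    have htF' : ∀ c, F.trans 0 1 c (b₀ F (hF.trans hr)) = t (Fin.cast hF c) (b₀ E hr) :=
      fun c => htF c _
    have hta : t a (b₀ E hr) = f a - m * f b := by
      rw [ht, Matrix.transvection_mul_apply_same, neg_mul, ← sub_eq_add_neg]
    have htc : ∀ c, c ≠ a → t c (b₀ E hr) = f c := fun c hc => by
      rw [ht, Matrix.transvection_mul_apply_of_ne _ _ _ _ hc]
    rw [← hcls]
    refine ihk _ ?_ F (hF.trans hr) ?_ rfl
    · rw [← hk, ← (finCongr hF).symm.sum_comp]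
      refine Finset.sum_lt_sum (fun c _ => ?_) ⟨a, Finset.mem_univ _, ?_⟩
      · rw [htF']
        by_cases hc : c = a
        · subst hc
          exact (congrArg (width N) hta).trans_le hmw.le
        · exact (congrArg (width N) (htc c hc)).le
      · rw [htF']
        exact (congrArg (width N) hta).trans_lt hmw
    · intro c
      rw [htF']
      by_cases hc : Fin.cast hF c = a
      · rw [hc, hta]; exact hmN
      · rw [htc _ hc]; exact hN _
  · push Not at h
    have hinv : E.trans 1 0 * E.trans 0 1 = 1 := (E.trans_mul 1 0 1).trans (E.trans_self 1)
    obtain ⟨a, ha⟩ : ∃ a, f a ≠ 0 := by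
      by_contra! h0
      have := congrFun₂ hinv (b₀ E hr) (b₀ E hr)
      rw [Matrix.mul_apply, Finset.sum_eq_zero fun c _ => by
        rw [show E.trans 0 1 c (b₀ E hr) = 0 from h0 c, mul_zero],
        Matrix.one_apply_eq] at this
      exact zero_ne_one this
    have hzero : ∀ c, c ≠ a → f c = 0 := fun c hc => by
      by_contra hc0
      exact lt_asymm (h c a hc hc0 ha) (h a c hc.symm ha hc0)
    obtain ⟨σ₀, hσ₀⟩ := exists_split_at hr a
    obtain ⟨σ₁, hσ₁⟩ := exists_split_at hr (b₀ E hr)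
    have h01 : ∀ c, E.trans 0 1 (σ₀ (.inr c)) (b₀ E hr) = 0 := fun c =>
      hzero _ (by rw [← hσ₀]; simp)
    have h10 : ∀ c, E.trans 1 0 (σ₁ (.inr c)) a = 0 := fun c => by
      have := congrFun₂ hinv (σ₁ (.inr c)) (b₀ E hr)
      rw [Matrix.mul_apply, Finset.sum_eq_single a (fun d _ hd => by
        rw [show E.trans 0 1 d (b₀ E hr) = 0 from hzero d hd, mul_zero]) (by simp),
        Matrix.one_apply_ne (by rw [← hσ₁]; simp)] at this
      exact (mul_eq_zero.1 this).resolve_right ha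
    have ht : ∀ (i j : Fin 2) c d, E.trans i j ((![σ₀, σ₁] : Fin 2 → _ ≃ _) i (.inr c))
        ((![σ₀, σ₁] : Fin 2 → _ ≃ _) j (.inl d)) = 0 := by
      intro i j c d
      obtain rfl := Subsingleton.elim d 0
      revert i j
      rw [Fin.forall_fin_two]
      constructor <;> rw [Fin.forall_fin_two]
      · refine ⟨?_, ?_⟩
        · rw [E.trans_self, Matrix.one_apply_ne (by simp)]
        · exact (congrArg _ hσ₁).trans (h01 c)
      · refine ⟨?_, ?_⟩
        · exact (congrArg _ hσ₀).trans (h10 c)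
        · rw [E.trans_self, Matrix.one_apply_ne (by simp)]
    rw [cls_eq_sub_add_quot E _ ht]
    refine add_mem ?_ (ih _ rfl)
    obtain ⟨w, hw⟩ := cls_plane_mem_range (E := subBundle E _ ht) rfl
    rw [hw]
    exact Submodule.subset_span ⟨w, rfl⟩

theorem span_charCls_plane : Submodule.span ℂ (Set.range (planeCharts n).charCls) = ⊤ :=
  span_charCls_eq_top cls_plane_mem_span

/-! ### The Koszul relation -/

/-- The direct sum of the trivial line bundles of weights `w 0` and `w 1`. -/
def charPair (w : Fin 2 → ℤ) : (planeCharts n).Bundle where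
  rank := 2
  wt _ := w
  trans _ _ := 1
  trans_self _ := rfl
  trans_mul _ _ _ := one_mul _
  trans_reg i j a b := reg_le_regOn_left i j (one_apply_mem_reg i a b)
  trans_homog _ _ a b := one_apply_mem_homog w a b

theorem cls_charPair (w : Fin 2 → ℤ) : cls (charPair (n := n) w) =
    (planeCharts n).charCls (w 0) + (planeCharts n).charCls (w 1) := by
  have h0 : ∀ a : Fin 1, finSumFinEquiv (m := 1) (n := 1) (.inl a) = 0 := by decide
  have h1 : ∀ a : Fin 1, finSumFinEquiv (m := 1) (n := 1) (.inr a) = 1 := by decide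
  refine cls_eq_add (E' := (planeCharts n).char (w 0)) (E'' := (planeCharts n).char (w 1))
    (fun _ => finSumFinEquiv (m := 1) (n := 1)) (fun i a => congrArg w (h0 a))
    (fun i a => congrArg w (h1 a)) (fun i j a b => ?_) (fun i j a b => ?_) (fun i j a b => ?_)
  · rw [char_trans_apply]
    exact (congrArg₂ (1 : Matrix (Fin 2) (Fin 2) (TorusAlg (ℤ × ℤ))) (h0 a) (h0 b)).trans
      (Matrix.one_apply_eq _)
  · rw [char_trans_apply]
    exact (congrArg₂ (1 : Matrix (Fin 2) (Fin 2) (TorusAlg (ℤ × ℤ))) (h1 a) (h1 b)).trans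
      (Matrix.one_apply_eq _)
  · exact (congrArg₂ (1 : Matrix (Fin 2) (Fin 2) (TorusAlg (ℤ × ℤ))) (h1 a) (h0 b)).trans
      (Matrix.one_apply_ne (by decide))

/-- The relation of the Koszul complex `0 → 𝒪 → ℂ₁ ⊕ ℂₙ → ℂₙ₊₁ → 0` of `z₁` and `z₂`, which is
exact because `z₁` and `z₂` have no common zero on `X`. -/
theorem koszul : (planeCharts n).charCls 1 + (planeCharts n).charCls n =
    1 + (planeCharts n).charCls (n + 1) := by
  rw [← charCls_zero]
  refine (cls_charPair ![1, (n : ℤ)]).symm.trans ?_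
  let x : ℤ → TorusAlg (ℤ × ℤ) := fun i => .single (i, 0) 1
  let y : ℤ → TorusAlg (ℤ × ℤ) := fun i => .single (0, i) 1
  have hx : x (-1) * x 1 = 1 := by
    simp [x, AddMonoidAlgebra.single_mul_single, AddMonoidAlgebra.one_def, Prod.mk_zero_zero]
  have hy : y (-1) * y 1 = 1 := by
    simp [y, AddMonoidAlgebra.single_mul_single, AddMonoidAlgebra.one_def, Prod.mk_zero_zero]
  have hxd : ∀ d : ℤ, 1 = d → x 1 ∈ (planeCharts n).homog d := fun d hd =>
    single_mem_homog (by rw [plane_deg, ← hd]; simp) _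
  have hyd : ∀ d : ℤ, n = d → y 1 ∈ (planeCharts n).homog d := fun d hd =>
    single_mem_homog (by rw [plane_deg, ← hd]; simp) _
  have hxr : ∀ i, x 1 ∈ (planeCharts n).reg i := by
    rw [Fin.forall_fin_two]
    exact ⟨single_mem_reg (mem_plane_chart_zero.2 le_rfl) _,
      single_mem_reg (mem_plane_chart_one.2 zero_le_one) _⟩
  have hyr : ∀ i, y 1 ∈ (planeCharts n).reg i := by
    rw [Fin.forall_fin_two]
    exact ⟨single_mem_reg (mem_plane_chart_zero.2 zero_le_one) _,
      single_mem_reg (mem_plane_chart_one.2 le_rfl) _⟩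
  have hx' : x (-1) ∈ (planeCharts n).reg 0 := single_mem_reg (mem_plane_chart_zero.2 le_rfl) _
  have hy' : y (-1) ∈ (planeCharts n).reg 1 := single_mem_reg (mem_plane_chart_one.2 le_rfl) _
  refine cls_exact (E' := (planeCharts n).char 0) (E'' := (planeCharts n).char (n + 1))
    (E := charPair ![1, (n : ℤ)])
    { mat := fun _ => (!![x 1; y 1] : Matrix (Fin 2) (Fin 1) (TorusAlg (ℤ × ℤ)))
      mat_reg := fun i => Fin.forall_fin_two.2 ⟨Fin.forall_fin_one.2 (hxr i),
        Fin.forall_fin_one.2 (hyr i)⟩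
      mat_homog := fun i => Fin.forall_fin_two.2 ⟨Fin.forall_fin_one.2 (hxd _ (sub_zero 1).symm),
        Fin.forall_fin_one.2 (hyd _ (sub_zero (n : ℤ)).symm)⟩
      comm := fun _ _ => (Matrix.mul_one _).trans (Matrix.one_mul _).symm }
    { mat := fun _ => (!![y 1, -x 1] : Matrix (Fin 1) (Fin 2) (TorusAlg (ℤ × ℤ)))
      mat_reg := fun i => Fin.forall_fin_one.2 (Fin.forall_fin_two.2 ⟨hyr i, neg_mem (hxr i)⟩)
      mat_homog := fun i => Fin.forall_fin_one.2 (Fin.forall_fin_two.2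
        ⟨hyd _ (add_sub_cancel_right (n : ℤ) 1).symm,
          neg_mem (hxd _ (add_sub_cancel_left (n : ℤ) 1).symm)⟩)
      comm := fun _ _ => (Matrix.mul_one _).trans (Matrix.one_mul _).symm } ?_
  refine Fin.forall_fin_two.2 ⟨?_, ?_⟩
  · refine ⟨(!![x (-1), 0] : Matrix (Fin 1) (Fin 2) (TorusAlg (ℤ × ℤ))),
      (!![0; -x (-1)] : Matrix (Fin 2) (Fin 1) (TorusAlg (ℤ × ℤ))),
      Fin.forall_fin_one.2 (Fin.forall_fin_two.2 ⟨hx', zero_mem _⟩),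
      Fin.forall_fin_two.2 ⟨Fin.forall_fin_one.2 (zero_mem _),
        Fin.forall_fin_one.2 (neg_mem hx')⟩, ?_, ?_, ?_⟩
    · change (!![x (-1), 0] : Matrix (Fin 1) (Fin 2) (TorusAlg (ℤ × ℤ))) *
        (!![x 1; y 1] : Matrix (Fin 2) (Fin 1) (TorusAlg (ℤ × ℤ))) = 1
      ext1 a b
      fin_cases a; fin_cases b
      simp [Matrix.mul_apply, hx]
    · change (!![y 1, -x 1] : Matrix (Fin 1) (Fin 2) (TorusAlg (ℤ × ℤ))) *
        (!![0; -x (-1)] : Matrix (Fin 2) (Fin 1) (TorusAlg (ℤ × ℤ))) = 1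
      ext1 a b
      fin_cases a; fin_cases b
      simp [Matrix.mul_apply, mul_comm (x 1), hx]
    · change (!![x 1; y 1] : Matrix (Fin 2) (Fin 1) (TorusAlg (ℤ × ℤ))) *
          (!![x (-1), 0] : Matrix (Fin 1) (Fin 2) (TorusAlg (ℤ × ℤ))) +
        (!![0; -x (-1)] : Matrix (Fin 2) (Fin 1) (TorusAlg (ℤ × ℤ))) *
          (!![y 1, -x 1] : Matrix (Fin 1) (Fin 2) (TorusAlg (ℤ × ℤ))) = 1
      ext1 a b
      fin_cases a <;> fin_cases b <;> simp [mul_comm _ (x (-1)), hx]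
  · refine ⟨(!![0, y (-1)] : Matrix (Fin 1) (Fin 2) (TorusAlg (ℤ × ℤ))),
      (!![y (-1); 0] : Matrix (Fin 2) (Fin 1) (TorusAlg (ℤ × ℤ))),
      Fin.forall_fin_one.2 (Fin.forall_fin_two.2 ⟨zero_mem _, hy'⟩),
      Fin.forall_fin_two.2 ⟨Fin.forall_fin_one.2 hy', Fin.forall_fin_one.2 (zero_mem _)⟩,
      ?_, ?_, ?_⟩
    · change (!![0, y (-1)] : Matrix (Fin 1) (Fin 2) (TorusAlg (ℤ × ℤ))) *
        (!![x 1; y 1] : Matrix (Fin 2) (Fin 1) (TorusAlg (ℤ × ℤ))) = 1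
      ext1 a b
      fin_cases a; fin_cases b
      simp [Matrix.mul_apply, hy]
    · change (!![y 1, -x 1] : Matrix (Fin 1) (Fin 2) (TorusAlg (ℤ × ℤ))) *
        (!![y (-1); 0] : Matrix (Fin 2) (Fin 1) (TorusAlg (ℤ × ℤ))) = 1
      ext1 a b
      fin_cases a; fin_cases b
      simp [Matrix.mul_apply, mul_comm (y 1), hy]
    · change (!![x 1; y 1] : Matrix (Fin 2) (Fin 1) (TorusAlg (ℤ × ℤ))) *
          (!![0, y (-1)] : Matrix (Fin 1) (Fin 2) (TorusAlg (ℤ × ℤ))) +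
        (!![y (-1); 0] : Matrix (Fin 2) (Fin 1) (TorusAlg (ℤ × ℤ))) *
          (!![y 1, -x 1] : Matrix (Fin 1) (Fin 2) (TorusAlg (ℤ × ℤ))) = 1
      ext1 a b
      fin_cases a <;> fin_cases b <;> simp [mul_comm _ (y (-1)), hy]

/-! ### K-theory classes as functions on the group of `n`-th roots of unity -/

theorem charCls_line_mul_self (q : ℤ) : (lineCharts n).charCls (n * q) = 1 := by
  have h : ∀ q : ℕ, (lineCharts n).charCls (n * q) = 1 := fun q => by
    rw [mul_comm, charCls_nsmul, charCls_line_self, one_pow]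
  obtain ⟨q, rfl | rfl⟩ := q.eq_nat_or_neg
  · exact h q
  · have h2 := charCls_add (U := lineCharts n) (n * q) (n * (-q))
    rwa [h, one_mul, mul_neg, add_neg_cancel, charCls_zero, ← mul_neg, eq_comm] at h2

theorem koszul_mul (w : ℤ) : ((planeCharts n).charCls n - 1) * (planeCharts n).charCls w =
    (planeCharts n).charCls n - 1 := by
  have h : ((planeCharts n).charCls n - 1) * (planeCharts n).charCls 1 =
      (planeCharts n).charCls n - 1 := by
    rw [sub_mul, one_mul, ← charCls_add, sub_eq_sub_iff_add_eq_add, add_comm _ (1 : KX n),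
      ← koszul, add_comm]
  have hinv : (planeCharts n).charCls 1 * (planeCharts n).charCls (-1) = 1 := by
    rw [← charCls_add, add_neg_cancel, charCls_zero]
  induction w with
  | zero => rw [charCls_zero, mul_one]
  | succ i ih => rw [charCls_add, ← mul_assoc, ih, h]
  | pred i ih =>
    rw [sub_eq_add_neg (-(i : ℤ)), charCls_add, ← mul_assoc, ih]
    conv_lhs => rw [← h]
    rw [mul_assoc, hinv, mul_one]

/-- The Koszul relation says that `χⁿ - 1` is fixed by multiplication with `χ`, so powers of
`χⁿ` grow linearly. -/
theorem charCls_plane_add_mul (r q : ℤ) : (planeCharts n).charCls (r + n * q) =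
    (planeCharts n).charCls r + (q : ℂ) • ((planeCharts n).charCls n - 1) := by
  induction q with
  | zero => simp
  | succ i ih =>
    have h := koszul_mul (n := n) (r + n * i)
    rw [sub_mul, one_mul, ← charCls_add, sub_eq_iff_eq_add] at h
    rw [show r + n * ((i : ℤ) + 1) = n + (r + n * i) by ring, h, ih]
    push_cast
    rw [add_smul, one_smul]
    abel
  | pred i ih =>
    have h := koszul_mul (n := n) (r + n * (-i - 1))
    rw [sub_mul, one_mul, ← charCls_add, sub_eq_iff_eq_add,
      show n + (r + n * (-(i : ℤ) - 1)) = r + n * (-i) by ring, ih] at h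
    rw [eq_comm, ← eq_sub_iff_add_eq'] at h
    rw [h]
    push_cast
    rw [sub_smul, one_smul]
    abel

theorem restrict_charCls (a : ℤ) : restrict n ((planeCharts n).charCls a) =
    (lineCharts n).charCls a := by
  rw [charCls, restrict_cls]
  exact cls_eq_charCls rfl (fun _ _ => rfl) fun _ _ => rfl

theorem fibre_charCls (a : ℤ) : fibre n ((lineCharts n).charCls a) = .single (a : ZMod n) 1 := by
  refine (Ideal.Quotient.lift_mk _ _ _).trans ?_
  refine (MvPolynomial.aeval_X _ _).trans ?_
  exact Fin.sum_univ_one _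

variable [NeZero n]

/-- The `n`-th root of unity `exp (2πi j / n)`. -/
def zeta (j : ZMod n) : ℂ := ZMod.stdAddChar j

theorem zeta_add (i j : ZMod n) : zeta (i + j) = zeta i * zeta j := AddChar.map_add_eq_mul _ _ _

theorem zeta_zero : zeta (0 : ZMod n) = 1 := AddChar.map_zero_eq_one _

theorem zeta_eq_one_iff {j : ZMod n} : zeta j = 1 ↔ j = 0 :=
  ⟨fun h => ZMod.injective_stdAddChar (h.trans zeta_zero.symm), fun h => h ▸ zeta_zero⟩

theorem zeta_nsmul (k : ℕ) (j : ZMod n) : zeta ((k : ZMod n) * j) = zeta j ^ k := by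
  rw [← nsmul_eq_mul]
  exact AddChar.map_nsmul_eq_pow _ _ _

theorem sum_zeta_mul (b : ZMod n) : ∑ j, zeta (j * b) = if b = 0 then (n : ℂ) else 0 := by
  have := AddChar.sum_mulShift b (ZMod.isPrimitive_stdAddChar n)
  rw [ZMod.card] at this
  exact_mod_cast this

theorem natCast_order_ne_zero : (n : ℂ) ≠ 0 := Nat.cast_ne_zero.2 (NeZero.ne n)

/-- The character of weight `a` as a function on the `n`-th roots of unity. -/
def charVec (a : ℤ) : ZMod n → ℂ := fun j => zeta ((a : ZMod n) * j)

theorem charVec_zero : (charVec 0 : ZMod n → ℂ) = 1 := by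
  ext j
  rw [charVec, Int.cast_zero, zero_mul, zeta_zero, Pi.one_apply]

theorem charVec_add (a b : ℤ) : (charVec (a + b) : ZMod n → ℂ) = charVec a * charVec b := by
  ext j
  rw [charVec, Int.cast_add, add_mul, zeta_add]
  rfl

theorem charVec_natCast_self : (charVec n : ZMod n → ℂ) = 1 := by
  ext j
  rw [charVec, Int.cast_natCast, ZMod.natCast_self, zero_mul, zeta_zero, Pi.one_apply]

theorem charVec_apply_zero (a : ℤ) : charVec a (0 : ZMod n) = 1 := by
  rw [charVec, mul_zero, zeta_zero]

theorem charVec_val (i : ZMod n) (j : ZMod n) : charVec i.val j = zeta (i * j) := by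
  rw [charVec, Int.cast_natCast, ZMod.natCast_zmod_val]

/-- The `i`-th Fourier coefficient. -/
def hat (i : ZMod n) : (ZMod n → ℂ) →ₗ[ℂ] ℂ :=
  (n : ℂ)⁻¹ • ∑ j, zeta (-(i * j)) • LinearMap.proj j

theorem hat_apply (i : ZMod n) (v : ZMod n → ℂ) :
    hat i v = (n : ℂ)⁻¹ * ∑ j, zeta (-(i * j)) * v j := by
  simp [hat]

theorem hat_charVec (i : ZMod n) (a : ℤ) :
    hat i (charVec a) = if i = (a : ZMod n) then 1 else 0 := by
  rw [hat_apply]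
  have : ∀ j, zeta (-(i * j)) * charVec a j = zeta (j * ((a : ZMod n) - i)) := fun j => by
    rw [charVec, ← zeta_add]
    congr 1
    ring
  simp only [this, sum_zeta_mul, sub_eq_zero, eq_comm (a := i)]
  split_ifs
  · exact inv_mul_cancel₀ natCast_order_ne_zero
  · exact mul_zero _

theorem fourier_inversion (v : ZMod n → ℂ) : v = ∑ i : ZMod n, hat i v • charVec i.val := by
  ext j
  rw [Finset.sum_apply]
  simp only [Pi.smul_apply, smul_eq_mul, hat_apply, charVec_val]
  have : ∀ i, (n : ℂ)⁻¹ * (∑ k, zeta (-(i * k)) * v k) * zeta (i * j) =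
      ∑ k, (n : ℂ)⁻¹ * v k * zeta (i * (j - k)) := fun i => by
    rw [mul_assoc, Finset.sum_mul, Finset.mul_sum]
    refine Finset.sum_congr rfl fun k _ => ?_
    rw [mul_sub, sub_eq_neg_add, zeta_add]
    ring
  simp only [this]
  rw [Finset.sum_comm]
  simp only [← Finset.mul_sum, sum_zeta_mul, sub_eq_zero]
  rw [Finset.sum_eq_single j (fun k _ hk => by rw [if_neg hk.symm, mul_zero]) (by simp),
    if_pos rfl, mul_assoc, mul_comm, mul_assoc, mul_inv_cancel₀ natCast_order_ne_zero, mul_one]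

theorem vec_induction {P : (ZMod n → ℂ) → Prop} (hc : ∀ i : ZMod n, P (charVec i.val))
    (hadd : ∀ x y, P x → P y → P (x + y)) (hsmul : ∀ (c : ℂ) x, P x → P (c • x)) (v) : P v := by
  rw [fourier_inversion v]
  refine Finset.sum_induction _ P hadd ?_ fun i _ => hsmul _ _ (hc i)
  rw [← zero_smul ℂ (charVec (n := n) (0 : ZMod n).val)]
  exact hsmul _ _ (hc 0)

/-- The pairs of a function on the `n`-th roots of unity and a derivative at `1` are spanned by
those of the characters, for which the derivative `χ d/dχ` of `χᵃ` at `1` is `a`. -/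
theorem pair_induction {P : (ZMod n → ℂ) × ℂ → Prop} (hc : ∀ a : ℤ, P (charVec a, a))
    (hadd : ∀ x y, P x → P y → P (x + y)) (hsmul : ∀ (c : ℂ) x, P x → P (c • x)) (x) : P x := by
  have h1 : ∀ v, ∃ b, P (v, b) := by
    refine vec_induction (fun i => ⟨_, hc _⟩) ?_ ?_
    · rintro x y ⟨b, hb⟩ ⟨c, hc⟩
      exact ⟨b + c, hadd _ _ hb hc⟩
    · rintro c x ⟨b, hb⟩
      exact ⟨c * b, hsmul c _ hb⟩
  have h2 : ∀ b, P (0, b) := by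
    intro b
    have := hsmul (b * (n : ℂ)⁻¹) _ (hadd _ _ (hc n) (hsmul (-1) _ (hc 0)))
    convert this using 1
    rw [charVec_natCast_self, charVec_zero]
    ext
    · simp
    · simp [natCast_order_ne_zero (n := n)]
  obtain ⟨b, hb⟩ := h1 x.1
  have := hadd _ _ hb (h2 (x.2 - b))
  rwa [Prod.mk_add_mk, add_zero, add_sub_cancel] at this

/-- The class on `Z` with given values at the `n`-th roots of unity: the isomorphism between
functions on `μₙ = Spec (K(Z) ⊗ ℂ)` and `K(Z) ⊗ ℂ = ℂ[χ] / (χⁿ - 1)`. -/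
def phiZ (n : ℕ) [NeZero n] : (ZMod n → ℂ) →ₗ[ℂ] KZ n :=
  ∑ i : ZMod n, (hat i).smulRight ((lineCharts n).charCls i.val)

/-- The class on `X` with given values at the `n`-th roots of unity and a given
derivative `χ d/dχ` at `1`, which is a double point of the spectrum of
`K(X) ⊗ ℂ = ℂ[χ, χ⁻¹] / ((χ - 1) (χⁿ - 1))`. -/
def phiX (n : ℕ) [NeZero n] : (ZMod n → ℂ) × ℂ →ₗ[ℂ] KX n :=
  ∑ i : ZMod n, (hat i ∘ₗ LinearMap.fst ℂ _ _).smulRight ((planeCharts n).charCls i.val) +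
    ((n : ℂ)⁻¹ • (LinearMap.snd ℂ _ _ -
      ∑ i : ZMod n, (i.val : ℂ) • hat i ∘ₗ LinearMap.fst ℂ _ _)).smulRight
        ((planeCharts n).charCls n - 1)

theorem phiZ_charVec (a : ℤ) : phiZ n (charVec a) = (lineCharts n).charCls a := by
  have : phiZ n (charVec a) = (lineCharts n).charCls (a : ZMod n).val := by
    simp [phiZ, hat_charVec]
  rw [this, ZMod.val_intCast]
  conv_rhs => rw [← Int.emod_add_mul_ediv a n, charCls_add, charCls_line_mul_self, mul_one]

theorem phiX_charVec (a : ℤ) : phiX n (charVec a, a) = (planeCharts n).charCls a := by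
  have : phiX n (charVec a, a) = (planeCharts n).charCls (a : ZMod n).val +
      ((n : ℂ)⁻¹ * (a - (a : ZMod n).val)) • ((planeCharts n).charCls n - 1) := by
    simp [phiX, hat_charVec]
  have h1 : ((a : ZMod n).val : ℤ) = a % n := ZMod.val_intCast a
  have h2 : ((a : ZMod n).val : ℂ) = (a % n : ℤ) := by exact_mod_cast congrArg (Int.cast : ℤ → ℂ) h1
  rw [this, h1, h2]
  conv_rhs => rw [← Int.emod_add_mul_ediv a n, charCls_plane_add_mul]
  congr 2
  have h3 : (a : ℂ) = (a % n : ℤ) + n * (a / n : ℤ) := by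
    exact_mod_cast congrArg (Int.cast : ℤ → ℂ) (Int.emod_add_mul_ediv a n).symm
  conv_lhs => rw [h3]
  rw [add_sub_cancel_left, inv_mul_cancel_left₀ natCast_order_ne_zero]

theorem phiX_one : phiX n (1, 0) = 1 := by
  have := phiX_charVec (n := n) 0
  rwa [charVec_zero, Int.cast_zero, charCls_zero] at this

theorem phiZ_mul (v w : ZMod n → ℂ) : phiZ n (v * w) = phiZ n v * phiZ n w := by
  refine vec_induction (P := fun v => phiZ n (v * w) = phiZ n v * phiZ n w) (fun i => ?_)
    (fun x y hx hy => by rw [add_mul, map_add, hx, hy, map_add, add_mul])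
    (fun c x hx => by rw [smul_mul_assoc, map_smul, hx, map_smul, smul_mul_assoc]) v
  refine vec_induction (P := fun w =>
      phiZ n (charVec i.val * w) = phiZ n (charVec i.val) * phiZ n w)
    (fun j => ?_) (fun x y hx hy => by rw [mul_add, map_add, hx, hy, map_add, mul_add])
    (fun c x hx => by rw [mul_smul_comm, map_smul, hx, map_smul, mul_smul_comm]) w
  rw [← charVec_add, phiZ_charVec, phiZ_charVec, phiZ_charVec, charCls_add]

/-- The product of functions and the Leibniz rule for the derivatives at `1`. -/
theorem phiX_mul (x y : (ZMod n → ℂ) × ℂ) :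
    phiX n (x.1 * y.1, x.1 0 * y.2 + x.2 * y.1 0) = phiX n x * phiX n y := by
  refine pair_induction (P := fun x => phiX n (x.1 * y.1, x.1 0 * y.2 + x.2 * y.1 0) =
    phiX n x * phiX n y) (fun a => ?_) (fun x x' hx hx' => ?_) (fun c x hx => ?_) x
  · refine pair_induction (P := fun y => phiX n (charVec a * y.1, charVec a 0 * y.2 + a * y.1 0) =
      phiX n (charVec a, (a : ℂ)) * phiX n y) (fun b => ?_) (fun y y' hy hy' => ?_)
      (fun c y hy => ?_) y
    · rw [phiX_charVec, phiX_charVec, ← charCls_add, ← phiX_charVec, charVec_add]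
      simp only [charVec_apply_zero]
      push_cast
      rw [one_mul, mul_one, add_comm]
    · rw [map_add, mul_add, ← hy, ← hy', ← map_add]
      congr 1
      ext
      · simp; ring
      · simp; ring
    · rw [map_smul, mul_smul_comm, ← hy, ← map_smul]
      congr 1
      ext
      · simp; ring
      · simp; ring
  · rw [map_add, add_mul, ← hx, ← hx', ← map_add]
    congr 1
    ext
    · simp; ring
    · simp; ring
  · rw [map_smul, smul_mul_assoc, ← hx, ← map_smul]
    congr 1
    ext
    · simp; ring
    · simp; ring

theorem phiZ_surjective : Function.Surjective (phiZ n) := by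
  rw [← LinearMap.range_eq_top, eq_top_iff, ← span_charCls_line, Submodule.span_le]
  rintro _ ⟨a, rfl⟩
  exact ⟨_, phiZ_charVec a⟩

theorem phiX_surjective : Function.Surjective (phiX n) := by
  rw [← LinearMap.range_eq_top, eq_top_iff, ← span_charCls_plane, Submodule.span_le]
  rintro _ ⟨a, rfl⟩
  exact ⟨_, phiX_charVec a⟩

theorem restrict_phiX (x : (ZMod n → ℂ) × ℂ) : restrict n (phiX n x) = phiZ n x.1 := by
  refine pair_induction (P := fun x => restrict n (phiX n x) = phiZ n x.1) (fun a => ?_)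
    (fun x y hx hy => ?_) (fun c x hx => ?_) x
  · rw [phiX_charVec, restrict_charCls, phiZ_charVec]
  · rw [map_add, map_add, hx, hy, ← map_add, Prod.fst_add]
  · rw [map_smul, map_smul, hx, ← map_smul, Prod.smul_fst]

theorem push_charCls (i : ZMod n) : push n ((lineCharts n).charCls i.val) =
    (planeCharts n).charCls i.val - (planeCharts n).charCls (i.val - 1) := by
  unfold push
  rw [LinearMap.comp_apply, LinearMap.comp_apply]
  change Finsupp.linearCombination ℂ _ ((fibre n ((lineCharts n).charCls i.val)).coeff) = _
  rw [fibre_charCls, AddMonoidAlgebra.coeff_single, Finsupp.linearCombination_single, one_smul,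
    Int.cast_natCast, ZMod.natCast_zmod_val]

/-- The Euler class of the normal bundle of `Z` as a function on the `n`-th roots of unity. -/
def eulerVec (n : ℕ) [NeZero n] : ZMod n → ℂ := fun j => 1 - zeta (-j)

theorem phiZ_eulerVec : phiZ n (eulerVec n) = (lineCharts n).euler 1 := by
  have : eulerVec n = charVec 0 - charVec (-1) := by
    ext j
    simp [eulerVec, charVec, zeta_zero]
  rw [this, map_sub, phiZ_charVec, phiZ_charVec, charCls_zero, euler]

/-- Pushforward from `Z` multiplies by the Euler class; at `1`, where the Euler class vanishes to
first order, only its derivative `1` is left. -/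
theorem push_phiZ (v : ZMod n → ℂ) : push n (phiZ n v) = phiX n (eulerVec n * v, v 0) := by
  refine vec_induction (P := fun v => push n (phiZ n v) = phiX n (eulerVec n * v, v 0))
    (fun i => ?_) (fun x y hx hy => ?_) (fun c x hx => ?_) v
  · rw [phiZ_charVec, push_charCls, ← phiX_charVec, ← phiX_charVec, ← map_sub]
    congr 1
    ext j
    · have h := congrFun (charVec_add (n := n) i.val (-1)) j
      rw [← sub_eq_add_neg] at h
      have h' : charVec (-1) j = zeta (-j) := by simp [charVec]
      change charVec i.val j - charVec (i.val - 1) j = (1 - zeta (-j)) * charVec i.val j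
      rw [h, Pi.mul_apply, h']
      ring
    · simp [charVec_apply_zero]
  · rw [map_add, map_add, hx, hy, ← map_add]
    congr 1
    rw [mul_add]
    rfl
  · rw [map_smul, map_smul, hx, ← map_smul]
    congr 1
    rw [mul_smul_comm]
    rfl

theorem phiZ_bott (k : ℕ) : phiZ n (fun j => ∑ i ∈ Finset.range k, zeta (-j) ^ i) =
    (lineCharts n).bott k (-1) := by
  have : (fun j : ZMod n => ∑ i ∈ Finset.range k, zeta (-j) ^ i) =
      ∑ i ∈ Finset.range k, charVec (i * (-1)) := by
    ext j
    rw [Finset.sum_apply]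
    refine Finset.sum_congr rfl fun i _ => ?_
    rw [← zeta_nsmul, charVec]
    congr 1
    push_cast
    ring
  rw [this, map_sum, bott]
  exact Finset.sum_congr rfl fun i _ => by rw [phiZ_charVec, charCls_nsmul]

/-- The Adams operation `ψᵏ` is the pullback of functions along the `k`-th power map. -/
theorem phiZ_mem_adamsGraph {k : ℕ} (hk : 1 ≤ k) (v : ZMod n → ℂ) :
    (phiZ n v, phiZ n fun j => v ((k : ZMod n) * j)) ∈ (lineCharts n).adamsGraph k := by
  refine vec_induction (P := fun v => (phiZ n v, phiZ n fun j => v ((k : ZMod n) * j)) ∈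
    (lineCharts n).adamsGraph k) (fun i => ?_) (fun x y hx hy => ?_) (fun c x hx => ?_) v
  · have : (fun j : ZMod n => charVec i.val ((k : ZMod n) * j)) = charVec (k * i.val) := by
      ext j
      rw [charVec, charVec]
      push_cast
      congr 1
      ring
    rw [this, phiZ_charVec, phiZ_charVec]
    exact charCls_mem_adamsGraph hk _
  · have := add_mem hx hy
    rw [Prod.mk_add_mk, ← map_add, ← map_add] at this
    exact this
  · have := Submodule.smul_mem _ c hx
    rw [Prod.smul_mk, ← map_smul, ← map_smul] at this
    exact this

theorem phiX_mem_adamsGraph {k : ℕ} (hk : 1 ≤ k) (x : (ZMod n → ℂ) × ℂ) :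
    (phiX n x, phiX n (fun j => x.1 ((k : ZMod n) * j), k * x.2)) ∈
      (planeCharts n).adamsGraph k := by
  refine pair_induction (P := fun x =>
    (phiX n x, phiX n (fun j => x.1 ((k : ZMod n) * j), k * x.2)) ∈ (planeCharts n).adamsGraph k)
    (fun a => ?_) (fun x y hx hy => ?_) (fun c x hx => ?_) x
  · have : ((fun j : ZMod n => charVec a ((k : ZMod n) * j), (k : ℂ) * a) : (ZMod n → ℂ) × ℂ) =
        (charVec (k * a), ((k * a : ℤ) : ℂ)) := by
      ext j
      · simp only [charVec]
        push_cast
        congr 1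
        ring
      · push_cast
        rfl
    rw [this, phiX_charVec, phiX_charVec]
    exact charCls_mem_adamsGraph hk _
  · have := add_mem hx hy
    rw [Prod.mk_add_mk, ← map_add, ← map_add] at this
    convert this using 3
    exact Prod.ext rfl (mul_add _ _ _)
  · have := Submodule.smul_mem _ c hx
    rw [Prod.smul_mk, ← map_smul, ← map_smul] at this
    convert this using 3
    exact Prod.ext rfl (mul_smul_comm _ _ _)

/-! ### The virtual line elements -/

theorem eulerVec_zero : eulerVec n 0 = 0 := by
  rw [eulerVec, neg_zero, zeta_zero, sub_self]

theorem eulerVec_ne_zero {j : ZMod n} (hj : j ≠ 0) : eulerVec n j ≠ 0 :=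
  sub_ne_zero.2 fun h => hj (neg_eq_zero.1 (zeta_eq_one_iff.1 h.symm))

/-- The coefficient at `m` of the element of the group algebra `ℂ[ℤ/n]` on which the character
`c` takes the value `exp (2πi j s(c) / n)`. -/
def groupCoeff (s : ZMod n → ZMod n) (j m : ZMod n) : ℂ :=
  (n : ℂ)⁻¹ * ∑ c, zeta (j * s c - c * m)

theorem groupCoeff_zero (s : ZMod n → ZMod n) (m : ZMod n) :
    groupCoeff s 0 m = if m = 0 then 1 else 0 := by
  have : ∀ c, zeta (0 * s c - c * m) = zeta (c * (-m)) := fun c => by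
    congr 1
    ring
  simp only [groupCoeff, this, sum_zeta_mul, neg_eq_zero]
  split_ifs
  · exact inv_mul_cancel₀ natCast_order_ne_zero
  · exact mul_zero _

/-- Multiplicativity in `ℂ[ℤ/n]`: the coefficients convolve. -/
theorem sum_groupCoeff_mul (s : ZMod n → ZMod n) (i j m : ZMod n) :
    ∑ k, groupCoeff s i k * groupCoeff s j (m - k) = groupCoeff s (i + j) m := by
  have h : ∀ k, groupCoeff s i k * groupCoeff s j (m - k) =
      ∑ c, ∑ d, (n : ℂ)⁻¹ * (n : ℂ)⁻¹ * zeta (i * s c + j * s d - d * m) * zeta (k * (d - c)) := by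
    intro k
    rw [groupCoeff, groupCoeff, mul_mul_mul_comm, Finset.sum_mul_sum, Finset.mul_sum]
    refine Finset.sum_congr rfl fun c _ => ?_
    rw [Finset.mul_sum]
    refine Finset.sum_congr rfl fun d _ => ?_
    rw [mul_assoc _ (zeta _), ← zeta_add, ← zeta_add]
    congr 2
    ring
  simp only [h]
  rw [Finset.sum_comm, groupCoeff, Finset.mul_sum]
  refine Finset.sum_congr rfl fun c _ => ?_
  rw [Finset.sum_comm, Finset.sum_eq_single c]
  · rw [← Finset.mul_sum, sum_zeta_mul, sub_self, if_pos rfl, mul_assoc, mul_assoc,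
      mul_comm (zeta _), inv_mul_cancel_left₀ natCast_order_ne_zero, add_mul]
  · intro d _ hd
    rw [← Finset.mul_sum, sum_zeta_mul, if_neg (sub_ne_zero.2 hd), mul_zero]
  · simp

/-- Coordinates for the inertial K-theory: values at the `n`-th roots of unity on every sector, and
a derivative `χ d/dχ` at `1` on the untwisted sector. -/
abbrev Coord (n : ℕ) : Type := ((ZMod n → ℂ) × ℂ) × ({m : ZMod n // m ≠ 0} → ZMod n → ℂ)

/-- The inertial class with given coordinates. -/
def phi (n : ℕ) [NeZero n] : Coord n →ₗ[ℂ] IK n :=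
  (phiX n).prodMap (LinearMap.pi fun m => phiZ n ∘ₗ LinearMap.proj m)

theorem phi_surjective : Function.Surjective (phi n) := by
  rintro ⟨x, y⟩
  obtain ⟨v, rfl⟩ := phiX_surjective x
  choose w hw using fun m => phiZ_surjective (y m)
  exact ⟨(v, w), Prod.ext rfl (funext hw)⟩

/-- The coordinates of the virtual product. -/
theorem virtualMul_phi (x y : Coord n) : virtualMul (phi n x) (phi n y) =
    phi n ((x.1.1 * y.1.1 + ∑ m : {m : ZMod n // m ≠ 0},
        eulerVec n * (x.2 m * y.2 ⟨-m.1, neg_ne_zero.2 m.2⟩ * eulerVec n),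
      x.1.1 0 * y.1.2 + x.1.2 * y.1.1 0),
      fun m => x.1.1 * y.2 m + x.2 m * y.1.1 + ∑ k : {k : ZMod n // k ≠ 0},
        if h : m.1 - k.1 ≠ 0 then x.2 k * y.2 ⟨m.1 - k.1, h⟩ * eulerVec n else 0) := by
  refine Prod.ext ?_ (funext fun m => ?_)
  · change phiX n x.1 * phiX n y.1 + ∑ m : {m : ZMod n // m ≠ 0}, push n (phiZ n (x.2 m) *
      phiZ n (y.2 ⟨-m.1, neg_ne_zero.2 m.2⟩) * (lineCharts n).euler 1) = phiX n _
    simp only [← phiZ_eulerVec, ← phiZ_mul, push_phiZ, ← phiX_mul]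
    rw [← map_sum, ← map_add]
    congr 1
    ext j
    · simp [Prod.fst_sum]
    · simp [Prod.snd_sum, eulerVec_zero]
  · change restrict n (phiX n x.1) * phiZ n (y.2 m) + phiZ n (x.2 m) * restrict n (phiX n y.1) +
      ∑ k : {k : ZMod n // k ≠ 0}, (if h : m.1 - k.1 ≠ 0 then
        phiZ n (x.2 k) * phiZ n (y.2 ⟨m.1 - k.1, h⟩) * (lineCharts n).euler 1 else 0) =
      phiZ n (x.1.1 * y.2 m + x.2 m * y.1.1 +
        ∑ k : {k : ZMod n // k ≠ 0}, if h : m.1 - k.1 ≠ 0 then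
          x.2 k * y.2 ⟨m.1 - k.1, h⟩ * eulerVec n else 0)
    simp only [← phiZ_eulerVec, ← phiZ_mul, restrict_phiX]
    rw [map_add, map_add, map_sum]
    congr 1
    refine Finset.sum_congr rfl fun k _ => ?_
    split_ifs
    · rfl
    · rw [map_zero]

/-- The coordinates of the virtual line element with parameters `s`, `b`, `c`, raised to the
power `k`. At a root of unity `≠ 1` the virtual product, in the normalization given by the Euler
class, is that of the group algebra `ℂ[ℤ/n]`; at `1` it is that of a square-zero extension
of `ℂ`, with tangent vector `(b, c)`. -/
def lineElt (s : ZMod n → ZMod n) (b : ℂ) (c : {m : ZMod n // m ≠ 0} → ℂ) (k : ℤ) : Coord n :=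
  ((fun j => groupCoeff s (k * j) 0, k * b),
    fun m j => if j = 0 then k * c m else groupCoeff s (k * j) m / eulerVec n j)

theorem lineElt_zero (s : ZMod n → ZMod n) (b : ℂ) (c : {m : ZMod n // m ≠ 0} → ℂ) :
    phi n (lineElt s b c 0) = virtualOne n := by
  have : lineElt s b c 0 = ((1, 0), 0) := by
    refine Prod.ext (Prod.ext ?_ ?_) ?_
    · ext j
      simp [lineElt, groupCoeff_zero]
    · simp [lineElt]
    · ext m j
      simp [lineElt, groupCoeff_zero, m.2]
  rw [this]
  exact Prod.ext phiX_one (funext fun m => map_zero (phiZ n))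

theorem virtualMul_lineElt (s : ZMod n → ZMod n) (b : ℂ) (c : {m : ZMod n // m ≠ 0} → ℂ) (k l : ℤ) :
    virtualMul (phi n (lineElt s b c k)) (phi n (lineElt s b c l)) =
      phi n (lineElt s b c (k + l)) := by
  rw [virtualMul_phi]
  have hadd : ∀ j m : ZMod n, groupCoeff s (((k + l : ℤ) : ZMod n) * j) m =
      ∑ p, groupCoeff s (k * j) p * groupCoeff s (l * j) (m - p) := fun j m => by
    rw [sum_groupCoeff_mul, Int.cast_add, add_mul]
  congr 1
  refine Prod.ext (Prod.ext ?_ ?_) ?_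
  · ext j
    by_cases hj : j = 0
    · subst hj
      simp [lineElt, groupCoeff_zero, eulerVec_zero]
    · have he := eulerVec_ne_zero hj
      have hs : ∀ m : {m : ZMod n // m ≠ 0}, eulerVec n j * (groupCoeff s (k * j) m / eulerVec n j *
          (groupCoeff s (l * j) (-m.1) / eulerVec n j) * eulerVec n j) =
          groupCoeff s (k * j) m * groupCoeff s (l * j) (0 - m.1) := fun m => by
        rw [zero_sub]
        field_simp
      simp only [lineElt, hadd, Pi.add_apply, Pi.mul_apply, Finset.sum_apply, if_neg hj, hs]
      rw [Fintype.sum_eq_add_sum_subtype_ne _ (0 : ZMod n), sub_zero]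
  · simp [lineElt, groupCoeff_zero]
    ring
  · ext m j
    by_cases hj : j = 0
    · subst hj
      have : ∀ p : {p : ZMod n // p ≠ 0}, (if h : m.1 - p.1 ≠ 0 then
          (lineElt s b c k).2 p * (lineElt s b c l).2 ⟨m.1 - p.1, h⟩ * eulerVec n else 0) 0 =
            0 := by
        intro p
        split_ifs
        · rw [Pi.mul_apply, eulerVec_zero, mul_zero]
        · rfl
      simp only [Pi.add_apply, Finset.sum_apply, this]
      simp [lineElt, groupCoeff_zero]
      ring
    · have he := eulerVec_ne_zero hj
      have hs : ∀ p : {p : ZMod n // p ≠ 0}, (if h : m.1 - p.1 ≠ 0 then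
          (lineElt s b c k).2 p * (lineElt s b c l).2 ⟨m.1 - p.1, h⟩ * eulerVec n else 0) j =
          groupCoeff s (k * j) p * groupCoeff s (l * j) (m.1 - p.1) / eulerVec n j -
          if p = m then groupCoeff s (k * j) m * groupCoeff s (l * j) 0 / eulerVec n j else 0 := by
        intro p
        by_cases hp : p = m
        · subst hp
          simp
        · have hmp : m.1 - p.1 ≠ 0 := fun h => hp (Subtype.ext (sub_eq_zero.1 h).symm)
          rw [dif_pos hmp, if_neg hp, sub_zero]
          simp only [lineElt, Pi.mul_apply, if_neg hj]
          field_simp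
      simp only [Pi.add_apply, Finset.sum_apply, hs]
      rw [Finset.sum_sub_distrib, Finset.sum_ite_eq' Finset.univ m, if_pos (Finset.mem_univ _)]
      simp only [lineElt, hadd, Pi.mul_apply, if_neg hj]
      rw [Fintype.sum_eq_add_sum_subtype_ne _ (0 : ZMod n), sub_zero, ← Finset.sum_div]
      ring

theorem virtualPow_lineElt (s : ZMod n → ZMod n) (b : ℂ) (c : {m : ZMod n // m ≠ 0} → ℂ) (k : ℕ) :
    virtualPow (phi n (lineElt s b c 1)) k = phi n (lineElt s b c k) := by
  induction k with
  | zero => rw [virtualPow, Nat.cast_zero, lineElt_zero]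
  | succ k ih => rw [virtualPow, ih, virtualMul_lineElt, Nat.cast_succ]

theorem isVirtualAdams_lineElt (s : ZMod n → ZMod n) (b : ℂ) (c : {m : ZMod n // m ≠ 0} → ℂ) {k : ℕ}
    (hk : 1 ≤ k) : IsVirtualAdams k (phi n (lineElt s b c 1)) (phi n (lineElt s b c k)) := by
  refine ⟨?_, fun m => ?_⟩
  · have := phiX_mem_adamsGraph hk (lineElt s b c 1).1
    have h : (lineElt s b c k).1 = (fun j => (lineElt s b c 1).1.1 ((k : ZMod n) * j),
        (k : ℂ) * (lineElt s b c 1).1.2) := by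
      simp [lineElt]
    rw [← h] at this
    exact this
  · refine ⟨_, phiZ_mem_adamsGraph hk _, ?_⟩
    rw [← phiZ_bott, ← phiZ_mul]
    change phiZ n ((lineElt s b c k).2 m) =
      phiZ n ((fun j => (lineElt s b c 1).2 m ((k : ZMod n) * j)) * _)
    congr 1
    ext j
    rw [Pi.mul_apply]
    by_cases hj : j = 0
    · subst hj
      simp [lineElt, zeta_zero, mul_comm]
    · have he := eulerVec_ne_zero hj
      -- `θᵏ(L) (1 - L) = 1 - Lᵏ`
      have hgeom : (∑ i ∈ Finset.range k, zeta (-j) ^ i) * eulerVec n j =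
          eulerVec n (k * j) := by
        rw [eulerVec, eulerVec, mul_comm, mul_neg_geom_sum, ← zeta_nsmul, mul_neg]
      have hgeom' := (eq_div_iff he).2 hgeom
      rw [hgeom']
      by_cases hkj : (k : ZMod n) * j = 0
      · simp [lineElt, hkj, hj, groupCoeff_zero, eulerVec_zero, m.2]
      · have he' := eulerVec_ne_zero hkj
        simp only [lineElt, if_neg hj, if_neg hkj, Int.cast_one, one_mul, Int.cast_natCast]
        field_simp

theorem lineElt_mem (s : ZMod n → ZMod n) (b : ℂ) (c : {m : ZMod n // m ≠ 0} → ℂ) :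
    phi n (lineElt s b c 1) ∈ virtualLineElements n := by
  refine ⟨⟨phi n (lineElt s b c (-1)), ?_, ?_⟩, fun k hk => ?_⟩
  · rw [virtualMul_lineElt, add_neg_cancel, lineElt_zero]
  · rw [virtualMul_lineElt, neg_add_cancel, lineElt_zero]
  · rw [virtualPow_lineElt]
    exact isVirtualAdams_lineElt s b c hk

/-! ### The virtual line elements span -/

/-- The vector with coordinates `x` on the untwisted and `y` on the twisted sectors, all at the
root of unity with index `i`. -/
def pointVec (i : ZMod n) (x : ℂ) (y : {m : ZMod n // m ≠ 0} → ℂ) : Coord n :=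
  ((Pi.single i x, 0), fun m => Pi.single i (y m))

theorem sum_smul_groupCoeff_single {i : ZMod n} (hi : i ≠ 0) (d j m : ZMod n) :
    ∑ t, zeta (-(i * t)) * groupCoeff (Pi.single d t) j m =
      if j = i then zeta (-(d * m)) else 0 := by
  have h : ∀ t, zeta (-(i * t)) * groupCoeff (Pi.single d t) j m =
      (n : ℂ)⁻¹ * (∑ c, if c = d then zeta (-(d * m)) * zeta (t * (j - i)) else
        zeta (-(c * m)) * zeta (t * (-i))) := by
    intro t
    rw [groupCoeff, mul_left_comm, Finset.mul_sum]
    congr 1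
    refine Finset.sum_congr rfl fun c _ => ?_
    by_cases hc : c = d
    · subst hc
      rw [if_pos rfl, Pi.single_eq_same, ← zeta_add, ← zeta_add]
      congr 1
      ring
    · rw [if_neg hc, Pi.single_eq_of_ne hc, ← zeta_add, ← zeta_add]
      congr 1
      ring
  simp only [h]
  rw [← Finset.mul_sum, Finset.sum_comm, Finset.sum_eq_single d]
  · simp only [if_pos]
    rw [← Finset.mul_sum, sum_zeta_mul]
    simp only [sub_eq_zero]
    split_ifs
    · rw [mul_comm, mul_assoc, mul_inv_cancel₀ natCast_order_ne_zero, mul_one]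
    · simp
  · intro c _ hc
    simp only [if_neg hc]
    rw [← Finset.mul_sum, sum_zeta_mul, if_neg (neg_ne_zero.2 hi), mul_zero]
  · simp

theorem span_lineElt : Submodule.span ℂ (Set.range fun p :
    (ZMod n → ZMod n) × ℂ × ({m : ZMod n // m ≠ 0} → ℂ) => lineElt p.1 p.2.1 p.2.2 1) = ⊤ := by
  classical
  set W := Submodule.span ℂ (Set.range fun p :
    (ZMod n → ZMod n) × ℂ × ({m : ZMod n // m ≠ 0} → ℂ) => lineElt p.1 p.2.1 p.2.2 1)
  have hW : ∀ s b c, lineElt s b c 1 ∈ W := fun s b c => Submodule.subset_span ⟨(s, b, c), rfl⟩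
  -- the directions tangent to the family at the root of unity `1`
  have htangent : ∀ (b : ℂ) (c : {m : ZMod n // m ≠ 0} → ℂ),
      (((0, b), fun m => Pi.single 0 (c m)) : Coord n) ∈ W := fun b c => by
    have := sub_mem (hW 0 b c) (hW 0 0 0)
    convert this using 1
    refine Prod.ext (Prod.ext ?_ ?_) ?_
    · ext j
      simp [lineElt]
    · simp [lineElt]
    · ext m j
      by_cases hj : j = 0
      · subst hj
        simp [lineElt]
      · simp [lineElt, hj]
  -- averaging over one parameter `s d` isolates one root of unity `i ≠ 1` and one character `d`
  have hchar : ∀ i : ZMod n, i ≠ 0 → ∀ d : ZMod n,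
      pointVec i 1 (fun m => zeta (-(d * m.1)) / eulerVec n i) ∈ W := by
    intro i hi d
    have := sum_mem (S := W) (t := Finset.univ) fun (t : ZMod n) _ =>
      Submodule.smul_mem W (zeta (-(i * t))) (hW (Pi.single d t) 0 0)
    convert this using 1
    have key := sum_smul_groupCoeff_single hi d
    refine Prod.ext (Prod.ext ?_ ?_) ?_
    · ext j
      simp only [Prod.fst_sum, Finset.sum_apply, pointVec, lineElt, Prod.smul_fst, Pi.smul_apply,
        smul_eq_mul, Int.cast_one, one_mul, key, mul_zero, neg_zero, zeta_zero, Pi.single_apply]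
    · simp [Prod.fst_sum, Prod.snd_sum, lineElt, pointVec]
    · ext m j
      simp only [Prod.snd_sum, Finset.sum_apply, pointVec, lineElt, Prod.smul_snd, Pi.smul_apply,
        smul_eq_mul, Int.cast_one, one_mul]
      by_cases hj : j = 0
      · subst hj
        simp [hi.symm]
      · simp only [if_neg hj, ← mul_div_assoc]
        rw [← Finset.sum_div, key, Pi.single_apply]
        split_ifs with h
        · rw [h]
        · rw [zero_div]
  have hpoint : ∀ i : ZMod n, i ≠ 0 → ∀ x y, pointVec i x y ∈ W := by
    intro i hi x y
    have he := eulerVec_ne_zero hi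
    let v : ZMod n → ℂ := fun m => if h : m = 0 then x else eulerVec n i * y ⟨-m, neg_ne_zero.2 h⟩
    have hv : ∀ m, ∑ d, hat d v * zeta (-(d * m)) = v (-m) := fun m => by
      conv_rhs => rw [fourier_inversion v]
      rw [Finset.sum_apply]
      refine Finset.sum_congr rfl fun d _ => ?_
      rw [Pi.smul_apply, charVec_val, smul_eq_mul, mul_neg]
    have := sum_mem (S := W) (t := Finset.univ) fun (d : ZMod n) _ =>
      Submodule.smul_mem W (hat d v) (hchar i hi d)
    convert this using 1
    refine Prod.ext (Prod.ext ?_ ?_) ?_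
    · ext j
      have h0 := hv 0
      simp only [mul_zero, neg_zero, zeta_zero, mul_one, v, dif_pos] at h0
      by_cases hj : j = i
      · subst hj
        simp [Prod.fst_sum, pointVec, v, h0]
      · simp [Prod.fst_sum, pointVec, hj]
    · simp [Prod.fst_sum, Prod.snd_sum, pointVec]
    · ext m j
      by_cases hj : j = i
      · subst hj
        have hm := hv m.1
        simp only [v, dif_neg (neg_ne_zero.2 m.2), neg_neg] at hm
        simp only [Prod.snd_sum, Finset.sum_apply, pointVec, Prod.smul_snd, Pi.smul_apply,
          Pi.single_eq_same, smul_eq_mul, ← mul_div_assoc]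
        rw [← Finset.sum_div, hm, mul_div_cancel_left₀ _ he]
      · simp [Prod.snd_sum, pointVec, hj]
  rw [eq_top_iff]
  rintro x -
  have := add_mem (add_mem (Submodule.smul_mem W (x.1.1 0) (hW 0 0 0))
    (htangent x.1.2 fun m => x.2 m 0)) (sum_mem (t := Finset.univ.erase (0 : ZMod n))
      fun i hi => hpoint i (Finset.ne_of_mem_erase hi) (x.1.1 i - x.1.1 0) fun m => x.2 m i)
  convert this using 1
  -- without parameters the line element is the identity of the virtual product
  have hone : ∀ j m : ZMod n, groupCoeff 0 j m = if m = 0 then 1 else 0 := fun j m => by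
    rw [← groupCoeff_zero 0 m]
    simp [groupCoeff]
  refine Prod.ext (Prod.ext ?_ ?_) ?_
  · ext j
    by_cases hj : j = 0
    · subst hj
      simp [Prod.fst_sum, pointVec, lineElt, hone, Pi.single_apply]
    · simp [Prod.fst_sum, pointVec, lineElt, hone, Pi.single_apply]
  · simp [Prod.fst_sum, Prod.snd_sum, pointVec, lineElt]
  · ext m j
    by_cases hj : j = 0
    · subst hj
      simp [Prod.snd_sum, pointVec, lineElt, Pi.single_apply]
    · simp [Prod.snd_sum, pointVec, lineElt, hone, Pi.single_apply, hj, m.2]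

end WeightedLine

end

theorem proposition7p2 (n : ℕ) [NeZero n] (hn : 2 ≤ n) :
    Submodule.span ℂ (WeightedLine.virtualLineElements n) = ⊤ := by
  rw [eq_top_iff, ← LinearMap.range_eq_top.2 WeightedLine.phi_surjective,
    LinearMap.range_eq_map, ← WeightedLine.span_lineElt, Submodule.map_span, Submodule.span_le]
  rintro _ ⟨_, ⟨p, rfl⟩, rfl⟩
  exact Submodule.subset_span (WeightedLine.lineElt_mem _ _ _)
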